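/- Let $G=\mathbb{Z}_3^3$, let $m'$ be a positive integer divisible by none of $2,3,5$, put $m=5m'$, and let $\zeta$ be a primitive complex $m$-th root of unity. Let $f:G\to\mathbb{Z}_m$ be a generalized bent function, i.e. $\bigl|\sum_{x\in G}\zeta^{f(x)}\chi(x)\bigr|^2=|G|=27$ for every character $\chi:G\to\mathbb{C}^*$. Let $C_m$ be the multiplicative cyclic group of order $m$ with generator $g$. For $x\in G$ let $E_x=\sum_{y\in G}g^{f(x+y)-f(y)}\in\mathbb{N}[C_m]$ be the autocorrelation element of $f$ at $x$. For $t\geq 1$ let $D_t\in\mathbb{N}[C_m]$ be the sum of all $d\in C_m$ with $d^t=1$; if $t\mid m$, these $d$ form the unique subgroup of order $t$. An element $X=\sum_{i\in\mathbb{Z}_m}a_ig^i\in\mathbb{N}[C_m]$ is a $v$-sum if $\sum_i a_i\zeta^i=0$. It is a minimal $v$-sum if it is a nonzero $v$-sum and no $Y=\sum_i b_ig^i$ with $0\le b_i\le a_i$ for all $i$ and $0\ne Y\neq X$ is a $v$-sum. The reduced exponent of a minimal $v$-sum $X$ is the smallest positive integer $r$ for which there is $j$ with $a_j\neq0$ such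 that $(\zeta^{i}\zeta^{-j})^r=1$ for all $i$ with $a_i\ne 0$. The $c$-exponent of a $v$-sum $X$ is the minimum, over all decompositions $X=X_1+\dots+X_s$ into minimal $v$-sums, of the least common multiple of the reduced exponents of $X_1,\dots,X_s$. Then for every $x\in G\setminus\{0\}$: (a) $E_x\neq D_5g^{\alpha}+D_{11}(g^{\beta}+g^{\gamma})$ for all integers $\alpha,\beta,\gamma$; (b) $E_x$ is a $v$-sum, and its $c$-exponent $k_x$ is not divisible by $11$. -/

import Mathlib

open scoped BigOperators

namespace GBF

/-- `f : G → ℤ/m` is a generalized bent function (with respect to the root of unity `ζ`, which is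
meant to be a primitive `m`-th root of unity): `|∑ₓ ζ^{f(x)} χ(x)|² = |G|` for all characters. -/
def IsGBF {G : Type*} [AddCommGroup G] [Fintype G] {m : ℕ} (ζ : ℂ) (f : G → ZMod m) : Prop :=
  ∀ χ : AddChar G ℂ, ‖∑ x : G, ζ ^ (f x).val * χ x‖ ^ 2 = (Fintype.card G : ℝ)

/-- The multiplicative cyclic group `C_m`, with generator `g = Multiplicative.ofAdd 1`. -/
abbrev C (m : ℕ) : Type := Multiplicative (ZMod m)

/-- The semiring `ℕ[C_m]`. -/
abbrev NC (m : ℕ) : Type := MonoidAlgebra ℕ (C m)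

/-- The element `g ^ k` of `ℕ[C_m]`; the exponent matters only modulo `m`. -/
noncomputable def gpow {m : ℕ} (k : ZMod m) : NC m :=
  MonoidAlgebra.single (Multiplicative.ofAdd k) 1

/-- The autocorrelation element `E_x = ∑_y g^{f(x+y) - f(y)}`. -/
noncomputable def autocorr {G : Type*} [AddCommGroup G] [Fintype G] {m : ℕ}
    (f : G → ZMod m) (x : G) : NC m :=
  ∑ y : G, gpow (f (x + y) - f y)

/-- `D_t`, the sum of all `d ∈ C_m` with `d ^ t = 1`. When `t ∣ m` these elements form the unique
subgroup of order `t`. -/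
noncomputable def D (m : ℕ) [NeZero m] (t : ℕ) : NC m :=
  ∑ d : C m with d ^ t = 1, MonoidAlgebra.single d 1

/-- The root of unity `ζ ^ i` that belongs to `g ^ i ∈ C_m`. -/
noncomputable def root {m : ℕ} (ζ : ℂ) (c : C m) : ℂ :=
  ζ ^ (Multiplicative.toAdd c).val

/-- `X = ∑ a_i g^i` is a `v`-sum: `∑ a_i ζ^i = 0`. -/
def IsVSum {m : ℕ} (ζ : ℂ) (X : NC m) : Prop :=
  ∑ c ∈ X.coeff.support, (X.coeff c : ℂ) * root ζ c = 0

/-- A minimal `v`-sum: a nonzero `v`-sum without nonzero proper `v`-subsums. -/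
def IsMinimalVSum {m : ℕ} (ζ : ℂ) (X : NC m) : Prop :=
  X ≠ 0 ∧ IsVSum ζ X ∧
    ∀ Y : NC m, (∀ c, Y.coeff c ≤ X.coeff c) → Y ≠ 0 → Y ≠ X → ¬ IsVSum ζ Y

/-- The reduced exponent: the smallest positive `r` such that, for some `η_j` occurring in
`∑ a_i ζ^i`, all `η_i` occurring in it satisfy `(η_i η_j⁻¹) ^ r = 1`. -/
noncomputable def reducedExponent {m : ℕ} (ζ : ℂ) (X : NC m) : ℕ :=
  sInf {r : ℕ | 0 < r ∧
    ∃ j ∈ X.coeff.support, ∀ i ∈ X.coeff.support, (root ζ i * (root ζ j)⁻¹) ^ r = 1}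

/-- `s` is a decomposition of `X` into minimal `v`-sums. -/
def IsDecomposition {m : ℕ} (ζ : ℂ) (X : NC m) (s : Multiset (NC m)) : Prop :=
  (∀ Y ∈ s, IsMinimalVSum ζ Y) ∧ s.sum = X

/-- The `c`-exponent of a `v`-sum `X`: the minimum, over all decompositions of `X` into minimal
`v`-sums, of the least common multiple of the reduced exponents of the parts. -/
noncomputable def cExponent {m : ℕ} (ζ : ℂ) (X : NC m) : ℕ :=
  sInf {k : ℕ | ∃ s : Multiset (NC m),
    IsDecomposition ζ X s ∧ k = (s.map (reducedExponent ζ)).lcm}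

end GBF

namespace GBF

set_option linter.unusedSectionVars false

/-! Part (b) reduces to (a). Orthogonality of characters makes each E_x with x ≠ 0 a v-sum of 27
roots of unity. All primes dividing m are at least 5, and for such m a nonempty vanishing sum of at
most 27 roots contains a full coset of a subgroup of prime order (`exists_torsion_coset_le`); so
minimal v-sums of that size are the elements D_p g^c, with reduced exponent p. If 11 divides k_x,
one part is a coset of order 11, and the other 16 roots can only split as 5 + 11: E_x has the form
excluded by (a).

For (a), suppose that E_x has this form. The differences f(x+y) - f(y) add up to zero on each line
y, y+x, y+2x. Write m' = 11^k q with q prime to 11 and project them to Z/5 and Z/q, which collapses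
each coset of order 11 to one value of multiplicity 11. Counting zero-sum triples
(`exists_two_exceptional_points`) shows that the Z/q-part vanishes everywhere and that the Z/5-part
is nonzero at just four points, two on each of two lines.

Now reduce modulo 11. In characteristic 11 a primitive 5q-th root of unity is a root of the m-th
cyclotomic polynomial, so f yields a function u into a field of characteristic 11 whose
autocorrelations Σ u(w+y)/u(y) vanish for w ≠ 0. This u is constant on all lines of direction x but
for one point on each of two lines. Its differences in direction x, correlated at the shift between
these two points, give twice a nonzero product, although that correlation is a combination of
vanishing autocorrelations (`not_two_exceptional_points`). -/

theorem gcd_mul_eq_zero {m a b : ℕ} {x : ZMod m} (ha : (a : ZMod m) * x = 0)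
    (hb : (b : ZMod m) * x = 0) : ((a.gcd b : ℕ) : ZMod m) * x = 0 := by
  have := congrArg (Int.cast : ℤ → ZMod m) (Nat.gcd_eq_gcd_ab a b)
  push_cast at this
  rw [this]
  linear_combination (a.gcdA b : ZMod m) * ha + (a.gcdB b : ZMod m) * hb

theorem eq_zero_of_coprime_mul {m a b : ℕ} (hab : a.Coprime b) {x : ZMod m}
    (ha : (a : ZMod m) * x = 0) (hb : (b : ZMod m) * x = 0) : x = 0 := by
  have := gcd_mul_eq_zero ha hb
  rwa [hab, Nat.cast_one, one_mul] at this

/-! ### Galois conjugation of relations between roots of unity -/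

section Character

variable {m : ℕ} [NeZero m] {e : AddChar (ZMod m) ℂ}

theorem char_eq_pow {R : Type*} [CommRing R] (e : AddChar (ZMod m) R) (i : ZMod m) :
    e i = e 1 ^ i.val := by
  rw [← AddChar.map_nsmul_eq_pow, nsmul_eq_mul, mul_one, ZMod.natCast_zmod_val]

theorem char_ne_zero {K : Type*} [Field K] (e : AddChar (ZMod m) K) (t : ZMod m) : e t ≠ 0 := fun h => by
  have : e t * e (-t) = 1 := by rw [← AddChar.map_add_eq_mul]; simp
  rw [h, zero_mul] at this
  exact zero_ne_one this

theorem isPrimitiveRoot_of_isPrimitive (he : e.IsPrimitive) : IsPrimitiveRoot (e 1) m := by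
  have key : ∀ l : ℕ, e 1 ^ l = 1 ↔ m ∣ l := by
    intro l
    rw [← AddChar.map_nsmul_eq_pow, nsmul_eq_mul, mul_one, he.zmod_char_eq_one_iff,
      ZMod.natCast_eq_zero_iff]
  exact ⟨(key m).2 dvd_rfl, fun l hl => (key l).1 hl⟩

/-- An integral relation between the values of a primitive character persists for every root of
the cyclotomic polynomial in any commutative ring. -/
theorem sum_pow_val_eq_zero (he : e.IsPrimitive) {a : ZMod m → ℤ}
    (ha : ∑ i, (a i : ℂ) * e i = 0) {R : Type*} [CommRing R] {z : R}
    (hz : (Polynomial.cyclotomic m R).IsRoot z) : ∑ i, (a i : R) * z ^ i.val = 0 := by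
  set P : Polynomial ℤ := ∑ i : ZMod m, Polynomial.C (a i) * Polynomial.X ^ i.val with hP
  have hprim := isPrimitiveRoot_of_isPrimitive he
  have h0 : Polynomial.aeval (e 1) P = 0 := by
    rw [hP, map_sum, ← ha]
    refine Finset.sum_congr rfl fun i _ => ?_
    rw [char_eq_pow e i]
    simp
  have hdvd : Polynomial.cyclotomic m ℤ ∣ P := by
    rw [Polynomial.cyclotomic_eq_minpoly hprim (NeZero.pos m)]
    exact minpoly.isIntegrallyClosed_dvd (hprim.isIntegral (NeZero.pos m)) h0
  obtain ⟨Q, hQ⟩ := hdvd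
  have h1 : Polynomial.eval₂ (Int.castRingHom R) z P = 0 := by
    rw [hQ, Polynomial.eval₂_mul, Polynomial.eval₂_eq_eval_map, Polynomial.map_cyclotomic_int,
      hz.eq_zero, zero_mul]
  rw [hP, Polynomial.eval₂_finsetSum] at h1
  rw [← h1]
  refine Finset.sum_congr rfl fun i _ => ?_
  rw [Polynomial.eval₂_mul, Polynomial.eval₂_C, Polynomial.eval₂_X_pow, eq_intCast]

/-- Galois conjugation: `e 1 ^ k` is another root of the cyclotomic polynomial. -/
theorem sum_char_unit_mul_eq_zero (he : e.IsPrimitive) {a : ZMod m → ℤ}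
    (ha : ∑ i, (a i : ℂ) * e i = 0) {k : ℕ} (hk : k.Coprime m) :
    ∑ i, (a i : ℂ) * e ((k : ZMod m) * i) = 0 := by
  have hz : (Polynomial.cyclotomic m ℂ).IsRoot (e 1 ^ k) :=
    ((isPrimitiveRoot_of_isPrimitive he).pow_of_coprime k hk).isRoot_cyclotomic (NeZero.pos m)
  rw [← sum_pow_val_eq_zero he ha hz]
  refine Finset.sum_congr rfl fun i _ => ?_
  rw [← nsmul_eq_mul, AddChar.map_nsmul_eq_pow, char_eq_pow e i, ← pow_mul, ← pow_mul, mul_comm k]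

/-- The part of a relation that lies in the coset `c + {i | n * i = 0}`. -/
noncomputable def cellVal (e : AddChar (ZMod m) ℂ) (n : ℕ) (a : ZMod m → ℤ) (c : ZMod m) : ℂ :=
  ∑ i, if (n : ZMod m) * (i - c) = 0 then (a i : ℂ) * e i else 0

/-- Fourier inversion: the indicator of `n * (i - c) = 0` is the average of the characters `e (u * n
* (i - c))` over `u`. -/
theorem card_mul_cellVal (he : e.IsPrimitive) (n : ℕ) (a : ZMod m → ℤ) (c : ZMod m) :
    (m : ℂ) * cellVal e n a c =
      ∑ u : ZMod m, e (-(u * n * c)) * ∑ i, (a i : ℂ) * e ((1 + u * n) * i) := by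
  simp_rw [cellVal, Finset.mul_sum]
  rw [Finset.sum_comm]
  refine Finset.sum_congr rfl fun i _ => ?_
  have h1 : ∀ u : ZMod m, e (-(u * n * c)) * ((a i : ℂ) * e ((1 + u * n) * i)) =
      (a i : ℂ) * e i * e (u * (n * (i - c))) := by
    intro u
    have : e (u * (n * (i - c))) * e i = e (-(u * n * c)) * e ((1 + u * n) * i) := by
      rw [← AddChar.map_add_eq_mul, ← AddChar.map_add_eq_mul]
      congr 1
      ring
    linear_combination (-(a i : ℂ)) * this
  simp_rw [h1]
  rw [← Finset.mul_sum, AddChar.sum_mulShift _ he, ZMod.card]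
  split_ifs <;> simp [mul_comm]

/-- In a vanishing sum the cells of a prime `p` are obtained from each other by multiplication
with `p`-th roots of unity. -/
theorem cellVal_add (he : e.IsPrimitive) {p k n : ℕ} (hp : p.Prime) (hm : m = p ^ k * n)
    {a : ZMod m → ℤ} (ha : ∑ i, (a i : ℂ) * e i = 0) {t : ZMod m}
    (ht : (p : ZMod m) * t = 0) (c : ZMod m) :
    cellVal e n a (c + t) = e t * cellVal e n a c := by
  have hm0 : (m : ℂ) ≠ 0 := Nat.cast_ne_zero.2 (NeZero.ne m)
  refine mul_left_cancel₀ hm0 ?_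
  rw [mul_left_comm, card_mul_cellVal he, card_mul_cellVal he, Finset.mul_sum]
  refine Finset.sum_congr rfl fun u _ => ?_
  -- The multiplier `1 + u * n` is always prime to `n`. If it is also prime to `p`, it is a unit and
  -- the inner sum is a conjugate of 0. Otherwise `p * t = 0` gives `u * n * t = -t`, the source of
  -- the factor `e t`.
  by_cases hu : p ∣ 1 + u.val * n
  · obtain ⟨w, hw⟩ := hu
    have hw' : (1 : ZMod m) + u * n = p * w := by
      have := congrArg (Nat.cast : ℕ → ZMod m) hw
      push_cast at this
      rwa [ZMod.natCast_zmod_val] at this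
    have h2 : -(u * n * (c + t)) = t + -(u * n * c) := by
      linear_combination (-t) * hw' - (w : ZMod m) * ht
    rw [h2, AddChar.map_add_eq_mul, mul_assoc]
  · have hcop : (1 + u.val * n).Coprime m := by
      have h1 := (((Nat.Prime.coprime_iff_not_dvd hp).2 hu).symm).pow_right k
      have h2 : (1 + u.val * n).Coprime n := by simp
      exact Nat.Coprime.coprime_dvd_right (dvd_of_eq hm) (h1.mul_right h2)
    have h3 := sum_char_unit_mul_eq_zero he ha hcop
    push_cast at h3
    rw [ZMod.natCast_zmod_val] at h3
    rw [h3]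
    simp

end Character

/-! ### Subgroups of prime order in Z/m -/

section Torsion

variable {m : ℕ} [NeZero m]

/-- The elements of `ℤ/m` annihilated by `p`. -/
def torsion (m : ℕ) [NeZero m] (p : ℕ) : Finset (ZMod m) :=
  Finset.univ.filter fun t => (p : ZMod m) * t = 0

@[simp] theorem mem_torsion {p : ℕ} {t : ZMod m} : t ∈ torsion m p ↔ (p : ZMod m) * t = 0 := by
  simp [torsion]

theorem card_torsion {p : ℕ} (hp : p ∣ m) : (torsion m p).card = p := by
  obtain ⟨n, hn⟩ := hp
  have hp0 : 0 < p := Nat.pos_of_ne_zero fun h => NeZero.ne m (by rw [hn, h, zero_mul])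
  have hn0 : 0 < n := Nat.pos_of_ne_zero fun h => NeZero.ne m (by rw [hn, h, mul_zero])
  have : torsion m p = (Finset.range p).image fun k => ((n * k : ℕ) : ZMod m) := by
    ext t
    rw [mem_torsion, Finset.mem_image]
    constructor
    · intro h
      have h' : ((p * t.val : ℕ) : ZMod m) = 0 := by
        push_cast; rwa [ZMod.natCast_zmod_val]
      rw [ZMod.natCast_eq_zero_iff] at h'
      obtain ⟨k, hk⟩ := Nat.dvd_of_mul_dvd_mul_left hp0 ((dvd_of_eq hn.symm).trans h')
      refine ⟨k, Finset.mem_range.2 ?_, ?_⟩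
      · have := ZMod.val_lt t
        rw [hk] at this
        have h3 : n * k < n * p := by rw [mul_comm n p, ← hn]; exact this
        exact lt_of_mul_lt_mul_left h3 hn0.le
      · rw [← hk, ZMod.natCast_zmod_val]
    · rintro ⟨k, -, rfl⟩
      rw [← Nat.cast_mul, ZMod.natCast_eq_zero_iff]
      exact ⟨k, by rw [hn]; ring⟩
  rw [this, Finset.card_image_of_injOn, Finset.card_range]
  intro k hk l hl hkl
  simp only [Finset.coe_range, Set.mem_Iio] at hk hl
  have hlt : ∀ k, k < p → n * k < m := fun k hk => by
    rw [hn, mul_comm p n]; exact Nat.mul_lt_mul_of_pos_left hk hn0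
  have := congrArg ZMod.val hkl
  simp only [] at this
  rw [ZMod.val_natCast_of_lt (hlt k hk), ZMod.val_natCast_of_lt (hlt l hl)] at this
  exact Nat.eq_of_mul_eq_mul_left hn0 this

theorem zero_mem_torsion (p : ℕ) : (0 : ZMod m) ∈ torsion m p := by simp

/-- A nontrivial character of the subgroup of order `p` sums to zero. -/
theorem sum_torsion_char {e : AddChar (ZMod m) ℂ} (he : e.IsPrimitive) {p : ℕ} (hp : p ∣ m)
    (hp1 : p ≠ 1) : ∑ t ∈ torsion m p, e t = 0 := by
  obtain ⟨n, hn⟩ := hp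
  set s : ZMod m := (n : ZMod m) with hs
  have hps : (p : ZMod m) * s = 0 := by
    rw [hs, ← Nat.cast_mul, ← hn, ZMod.natCast_self]
  have hes : e s ≠ 1 := by
    rw [Ne, he.zmod_char_eq_one_iff, hs, ZMod.natCast_eq_zero_iff]
    intro h
    have hn0 : 0 < n := Nat.pos_of_ne_zero fun h => NeZero.ne m (by rw [hn, h, mul_zero])
    have := Nat.le_of_dvd hn0 h
    have hp0 : p ≠ 0 := fun h => NeZero.ne m (by rw [hn, h, zero_mul])
    rw [hn] at this
    have : 2 ≤ p := by omega
    nlinarith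
  have h1 : ∑ t ∈ torsion m p, e t = ∑ t ∈ torsion m p, e (s + t) := by
    refine (Finset.sum_bij (fun t _ => s + t) ?_ ?_ ?_ ?_).symm
    · intro t ht
      rw [mem_torsion] at ht ⊢
      rw [mul_add, hps, ht, add_zero]
    · intro a _ b _ h; exact add_left_cancel h
    · intro t ht
      rw [mem_torsion] at ht
      refine ⟨t - s, ?_, by ring⟩
      rw [mem_torsion, mul_sub, hps, ht, sub_zero]
    · intros; rfl
  simp_rw [AddChar.map_add_eq_mul, ← Finset.mul_sum] at h1
  have h2 : (1 - e s) * ∑ t ∈ torsion m p, e t = 0 := by linear_combination h1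
  exact (mul_eq_zero.1 h2).resolve_left (sub_ne_zero.2 (Ne.symm hes))

end Torsion

/-! ### Cells of a prime, and short sums determined by their value -/

section Cells

variable {m : ℕ} [NeZero m] {e : AddChar (ZMod m) ℂ}

/-- The complex number represented by a multiset of elements of `ℤ/m`. -/
noncomputable def value (e : AddChar (ZMod m) ℂ) (U : ZMod m → ℕ) : ℂ := ∑ i, (U i : ℂ) * e i

/-- The part of `U` in the coset `c + {i | n * i = 0}`. -/
def cell (n : ℕ) (c : ZMod m) (U : ZMod m → ℕ) : ZMod m → ℕ :=
  fun i => if (n : ZMod m) * (i - c) = 0 then U i else 0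

/-- The translate of `U` by `t`. -/
def translate (t : ZMod m) (U : ZMod m → ℕ) : ZMod m → ℕ := fun i => U (i - t)

/-- `U` lives on the coset `c + {i | N * i = 0}`. -/
def SupportedOn (N : ℕ) (c : ZMod m) (U : ZMod m → ℕ) : Prop :=
  ∀ i, U i ≠ 0 → (N : ZMod m) * (i - c) = 0

theorem value_add (U V : ZMod m → ℕ) : value e (U + V) = value e U + value e V := by
  simp [value, add_mul, Finset.sum_add_distrib]

theorem value_translate (t : ZMod m) (U : ZMod m → ℕ) :
    value e (translate t U) = e t * value e U := by
  rw [value, value, ← Equiv.sum_comp (Equiv.addRight t), Finset.mul_sum]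
  refine Finset.sum_congr rfl fun i _ => ?_
  simp only [translate, Equiv.coe_addRight, add_sub_cancel_right, AddChar.map_add_eq_mul]
  ring

theorem sum_translate (t : ZMod m) (U : ZMod m → ℕ) : ∑ i, translate t U i = ∑ i, U i := by
  rw [← Equiv.sum_comp (Equiv.addRight t)]
  simp [translate]

theorem eq_zero_of_sum_eq_zero {U : ZMod m → ℕ} (h : ∑ i, U i = 0) : U = 0 := by
  ext i
  exact (Finset.sum_eq_zero_iff.1 h) i (Finset.mem_univ i)

theorem value_zero : value e (0 : ZMod m → ℕ) = 0 := by simp [value]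

theorem cell_le (n : ℕ) (c : ZMod m) (U : ZMod m → ℕ) (i : ZMod m) : cell n c U i ≤ U i := by
  unfold cell; split_ifs <;> simp

theorem cell_self (n : ℕ) (c : ZMod m) (U : ZMod m → ℕ) : cell n c U c = U c := by
  simp [cell]

theorem value_cell (n : ℕ) (c : ZMod m) (U : ZMod m → ℕ) :
    value e (cell n c U) = cellVal e n (fun i => (U i : ℤ)) c := by
  unfold value cellVal cell
  refine Finset.sum_congr rfl fun i _ => ?_
  split_ifs <;> simp

theorem cellVal_sub (n : ℕ) (c : ZMod m) (U V : ZMod m → ℕ) :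
    cellVal e n (fun i => (V i : ℤ) - U i) c = value e (cell n c V) - value e (cell n c U) := by
  rw [value_cell, value_cell]
  unfold cellVal
  rw [← Finset.sum_sub_distrib]
  refine Finset.sum_congr rfl fun i _ => ?_
  split_ifs
  · push_cast; ring
  · simp

theorem value_cell_sub_add (he : e.IsPrimitive) {p k n : ℕ} (hp : p.Prime) (hm : m = p ^ k * n)
    {U V : ZMod m → ℕ} (hUV : value e U = value e V) {t : ZMod m}
    (ht : (p : ZMod m) * t = 0) (c : ZMod m) :
    value e (cell n (c + t) V) - value e (cell n (c + t) U) =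
      e t * (value e (cell n c V) - value e (cell n c U)) := by
  rw [← cellVal_sub, ← cellVal_sub]
  refine cellVal_add he hp hm ?_ ht c
  have : ∑ i, (((V i : ℤ) - U i : ℤ) : ℂ) * e i = value e V - value e U := by
    unfold value
    rw [← Finset.sum_sub_distrib]
    refine Finset.sum_congr rfl fun i _ => ?_
    push_cast; ring
  rw [this, hUV, sub_self]

theorem value_cell_add (he : e.IsPrimitive) {p k n : ℕ} (hp : p.Prime) (hm : m = p ^ k * n)
    {U : ZMod m → ℕ} (hU : value e U = 0) {t : ZMod m}
    (ht : (p : ZMod m) * t = 0) (c : ZMod m) :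
    value e (cell n (c + t) U) = e t * value e (cell n c U) := by
  rw [value_cell, value_cell]
  exact cellVal_add he hp hm (by simpa [value] using hU) ht c

/-- Distinct `p`-torsion shifts give disjoint cells, because `p` is prime to `n`. -/
theorem sum_cells_le {p n : ℕ} (hpn : p.Coprime n) (c : ZMod m) (U : ZMod m → ℕ) :
    ∑ t ∈ torsion m p, ∑ i, cell n (c + t) U i ≤ ∑ i, U i := by
  rw [Finset.sum_comm]
  refine Finset.sum_le_sum fun i _ => ?_
  unfold cell
  by_cases h : ∃ t ∈ torsion m p, (n : ZMod m) * (i - (c + t)) = 0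
  · obtain ⟨t, ht, hti⟩ := h
    rw [Finset.sum_eq_single_of_mem t ht, if_pos hti]
    intro s hs hst
    rw [if_neg]
    intro hsi
    rw [mem_torsion] at hs ht
    refine hst (sub_eq_zero.1 (eq_zero_of_coprime_mul hpn ?_ ?_))
    · rw [mul_sub, hs, ht, sub_zero]
    · linear_combination hti - hsi
  · push Not at h
    rw [Finset.sum_eq_zero]
    · exact Nat.zero_le _
    · intro t ht
      rw [if_neg (h t ht)]

theorem exists_cell_lt {p n : ℕ} (hp : p ∣ m) (hpn : p.Coprime n) (c : ZMod m) {U : ZMod m → ℕ}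
    {B : ℕ} (h : ∑ i, U i < p * B) : ∃ t, (p : ZMod m) * t = 0 ∧ ∑ i, cell n (c + t) U i < B := by
  by_contra hcon
  push Not at hcon
  have h1 : ∑ t ∈ torsion m p, B ≤ ∑ t ∈ torsion m p, ∑ i, cell n (c + t) U i :=
    Finset.sum_le_sum fun t ht => hcon t (mem_torsion.1 ht)
  rw [Finset.sum_const, card_torsion hp, smul_eq_mul] at h1
  have := sum_cells_le hpn c U
  omega

/-- When `m = p ^ k * n` with `p ∤ n`, passing from `N` to `N.gcd n` removes the whole `p`-part; the
inductions below run on this. -/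
theorem SupportedOn.cell {N n : ℕ} {c₀ c : ZMod m} {U : ZMod m → ℕ} (hU : SupportedOn N c₀ U)
    (hc : (N : ZMod m) * (c - c₀) = 0) : SupportedOn (N.gcd n) c (cell n c U) := by
  intro i hi
  unfold GBF.cell at hi
  split_ifs at hi with h
  · refine gcd_mul_eq_zero ?_ h
    linear_combination hU i hi - hc
  · exact absurd rfl hi

theorem SupportedOn.translate_cell {N n p : ℕ} {c₀ c t : ZMod m} {U : ZMod m → ℕ}
    (hU : SupportedOn N c₀ U) (hc : (N : ZMod m) * (c - c₀) = 0) (hpN : p ∣ N)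
    (ht : (p : ZMod m) * t = 0) :
    SupportedOn (N.gcd n) c (translate (-t) (GBF.cell n (c + t) U)) := by
  intro i hi
  unfold translate GBF.cell at hi
  rw [sub_neg_eq_add] at hi
  split_ifs at hi with h
  · refine gcd_mul_eq_zero ?_ (by linear_combination h)
    obtain ⟨r, rfl⟩ := hpN
    have h1 := hU _ hi
    push_cast at h1 hc ⊢
    linear_combination h1 - hc - (r : ZMod m) * ht
  · exact absurd rfl hi

theorem SupportedOn.add {N : ℕ} {c : ZMod m} {U V : ZMod m → ℕ} (hU : SupportedOn N c U)
    (hV : SupportedOn N c V) : SupportedOn N c (U + V) := by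
  intro i hi
  by_cases h : U i = 0
  · exact hV i (by simpa [h] using hi)
  · exact hU i h

theorem SupportedOn.eq_of_ne_zero {c i : ZMod m} {U : ZMod m → ℕ} (hU : SupportedOn 1 c U)
    (hi : U i ≠ 0) : i = c := by
  have := hU i hi
  rw [Nat.cast_one, one_mul] at this
  exact sub_eq_zero.1 this

theorem SupportedOn.value_eq {c : ZMod m} {U : ZMod m → ℕ} (hU : SupportedOn 1 c U) :
    value e U = U c * e c := by
  unfold value
  refine Finset.sum_eq_single c (fun i _ hi => ?_) (by simp)
  by_contra h
  exact hi (hU.eq_of_ne_zero (i := i) fun h0 => h (by simp [h0]))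

theorem SupportedOn.le_of_value_eq {c : ZMod m} {U V : ZMod m → ℕ} (hU : SupportedOn 1 c U)
    (hV : SupportedOn 1 c V) (h : value e U = value e V) : U ≤ V := by
  rw [hU.value_eq, hV.value_eq] at h
  have h0 : e c ≠ 0 := char_ne_zero e c
  have h1 : U c = V c := by exact_mod_cast mul_right_cancel₀ h0 h
  intro i
  by_cases hi : U i = 0
  · rw [hi]; exact Nat.zero_le _
  · rw [hU.eq_of_ne_zero hi, h1]

/-- A prime power splitting of `m`. -/
theorem exists_eq_pow_mul {p : ℕ} (hp : p.Prime) :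
    ∃ k n, m = p ^ k * n ∧ ¬ p ∣ n ∧ p.Coprime n := by
  obtain ⟨k, n, hn, h⟩ := Nat.exists_eq_pow_mul_and_not_dvd (NeZero.ne m) p hp.ne_one
  exact ⟨k, n, h, hn, (Nat.Prime.coprime_iff_not_dvd hp).2 hn⟩

/-- If a cell of `U` is empty, then the corresponding cell of `V` measures the difference between
`U` and `V` on every other cell. -/
theorem value_translate_add (he : e.IsPrimitive) {p k n : ℕ} (hp : p.Prime) (hm : m = p ^ k * n)
    {U V : ZMod m → ℕ} (hUV : value e U = value e V) {c t : ZMod m}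
    (ht : (p : ZMod m) * t = 0) (h0 : cell n (c + t) U = 0) :
    value e (translate (-t) (cell n (c + t) V) + cell n c U) = value e (cell n c V) := by
  have h1 := value_cell_sub_add he hp hm hUV ht c
  rw [h0, value_zero, sub_zero] at h1
  have h2 : e (-t) * e t = 1 := by rw [← AddChar.map_add_eq_mul]; simp
  rw [value_add, value_translate, h1]
  linear_combination (value e (cell n c V) - value e (cell n c U)) * h2

theorem sum_cell_mul_add (k n : ℕ) (c : ZMod m) (U V : ZMod m → ℕ) :
    ∑ i, cell n c (fun i => k * U i + V i) i = k * ∑ i, cell n c U i + ∑ i, cell n c V i := by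
  rw [Finset.mul_sum, ← Finset.sum_add_distrib]
  refine Finset.sum_congr rfl fun i _ => ?_
  unfold cell
  split_ifs <;> simp

/-- The reduction step: peel off the prime `p`, using a cell in which `U` is empty and `V` has
fewer than `B` elements. -/
theorem le_of_value_eq_step (he : e.IsPrimitive) {N p k n B : ℕ} (hp : p.Prime) (hpN : p ∣ N)
    (hNm : N ∣ m) (hm : m = p ^ k * n) (hpn : ¬ p ∣ n) {c₀ c : ZMod m} {U V : ZMod m → ℕ}
    (hU : SupportedOn N c₀ U) (hV : SupportedOn N c₀ V) (hUV : value e U = value e V)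
    (hsize : B * ∑ i, U i + ∑ i, V i < p * B) (hc : U c ≠ 0)
    (hstep : ∀ A : ZMod m → ℕ, SupportedOn (N.gcd n) c A → ∑ i, A i < B →
      value e (A + cell n c U) = value e (cell n c V) → A + cell n c U ≤ cell n c V) :
    U c ≤ V c := by
  have hcop : p.Coprime n := (Nat.Prime.coprime_iff_not_dvd hp).2 hpn
  -- With weight `B` on `U`, one pigeonhole does both jobs: a cell of weight below `B` has no
  -- element of `U` and fewer than `B` of `V`.
  have hsz : ∑ i, (fun i => B * U i + V i) i < p * B := by
    simpa [Finset.sum_add_distrib, Finset.mul_sum] using hsize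
  obtain ⟨t, ht, hlt⟩ := exists_cell_lt (hpN.trans hNm) hcop c hsz
  rw [sum_cell_mul_add] at hlt
  have h0 : ∑ i, cell n (c + t) U i = 0 := by
    by_contra h
    have : B ≤ B * ∑ i, cell n (c + t) U i := Nat.le_mul_of_pos_right _ (Nat.pos_of_ne_zero h)
    omega
  rw [h0, mul_zero, zero_add] at hlt
  have h1 := hstep _ (hV.translate_cell (hU c hc) hpN ht) (by rwa [sum_translate])
    (value_translate_add he hp hm hUV ht (eq_zero_of_sum_eq_zero h0)) c
  rw [cell_self] at h1
  have h2 : U c ≤ (translate (-t) (cell n (c + t) V) + cell n c U) c := by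
    rw [Pi.add_apply, cell_self]; exact Nat.le_add_left _ _
  exact h2.trans h1

theorem sum_cell_le (n : ℕ) (c : ZMod m) (U : ZMod m → ℕ) : ∑ i, cell n c U i ≤ ∑ i, U i :=
  Finset.sum_le_sum fun i _ => cell_le n c U i

theorem gcd_eq_one_of_forall_prime {N n p : ℕ} (hpn : ¬ p ∣ n)
    (hN : ∀ q : ℕ, q.Prime → q ∣ N → q = p) : N.gcd n = 1 := by
  by_contra h
  obtain ⟨q, hq, hqd⟩ := Nat.exists_prime_and_dvd h
  have := hN q hq (hqd.trans (Nat.gcd_dvd_left _ _))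
  exact hpn (this ▸ hqd.trans (Nat.gcd_dvd_right _ _))

/-- Over a single prime `5`, fewer than five roots of unity are determined by their sum. -/
theorem le_of_value_eq_of_five (he : e.IsPrimitive) {N : ℕ} (hNm : N ∣ m)
    (hN : ∀ q : ℕ, q.Prime → q ∣ N → q = 5) {c₀ : ZMod m} {U V : ZMod m → ℕ}
    (hU : SupportedOn N c₀ U) (hV : SupportedOn N c₀ V) (hUV : value e U = value e V)
    (hsize : ∑ i, U i ≤ 4) : U ≤ V := by
  by_cases hN1 : N = 1
  · subst hN1; exact hU.le_of_value_eq hV hUV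
  obtain ⟨q, hq, hqN⟩ := Nat.exists_prime_and_dvd hN1
  obtain rfl : q = 5 := hN q hq hqN
  obtain ⟨k, n, hm, hpn, hcop⟩ := exists_eq_pow_mul (m := m) hq
  have hg := gcd_eq_one_of_forall_prime hpn hN
  intro c
  by_cases hc : U c = 0
  · rw [hc]; exact Nat.zero_le _
  have hUc := hU c hc
  -- Four elements leave one of five cells empty; after removal of the prime 5 the cells are single
  -- points.
  obtain ⟨t, ht, hlt⟩ := exists_cell_lt (hqN.trans hNm) hcop c (U := U) (B := 1)
    (by omega)
  have h1 := value_translate_add he hq hm hUV ht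
    (eq_zero_of_sum_eq_zero (Nat.lt_one_iff.1 hlt))
  have hs1 := (hV.translate_cell (n := n) hUc hqN ht).add (hU.cell (n := n) hUc)
  have hs2 := hV.cell (n := n) hUc
  rw [hg] at hs1 hs2
  have h2 := hs1.le_of_value_eq hs2 h1 c
  rw [cell_self] at h2
  refine le_trans ?_ h2
  rw [Pi.add_apply, cell_self]; exact Nat.le_add_left _ _

/-- The bound 21 is 7 · 3: peeling off 7 with `B = 3` adds at most 2 elements to the at most 2 of
`U`, within the limit 4 for the prime 5. -/
theorem le_of_value_eq_of_seven (he : e.IsPrimitive) {N : ℕ} (hNm : N ∣ m)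
    (hN : ∀ q : ℕ, q.Prime → q ∣ N → q = 5 ∨ q = 7) {c₀ : ZMod m} {U V : ZMod m → ℕ}
    (hU : SupportedOn N c₀ U) (hV : SupportedOn N c₀ V) (hUV : value e U = value e V)
    (hsize : ∑ i, U i ≤ 2) (hsize' : 3 * ∑ i, U i + ∑ i, V i < 21) : U ≤ V := by
  by_cases h7 : 7 ∣ N
  · have hp : Nat.Prime 7 := by norm_num
    obtain ⟨k, n, hm, hpn, hcop⟩ := exists_eq_pow_mul (m := m) hp
    have hg : ∀ q : ℕ, q.Prime → q ∣ N.gcd n → q = 5 := by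
      intro q hq hqd
      rcases hN q hq (hqd.trans (Nat.gcd_dvd_left _ _)) with h | h
      · exact h
      · exact absurd (h ▸ hqd.trans (Nat.gcd_dvd_right _ _)) hpn
    intro c
    by_cases hc : U c = 0
    · rw [hc]; exact Nat.zero_le _
    refine le_of_value_eq_step he (B := 3) hp h7 hNm hm hpn hU hV hUV (by omega) hc ?_
    intro A hA hAs hAv
    refine le_of_value_eq_of_five he ((Nat.gcd_dvd_left _ _).trans hNm) hg
      (hA.add (hU.cell (hU c hc))) (hV.cell (hU c hc)) hAv ?_
    have := sum_cell_le n c U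
    simp only [Pi.add_apply, Finset.sum_add_distrib]
    omega
  · refine le_of_value_eq_of_five he hNm (fun q hq hqN => ?_) hU hV hUV (by omega)
    rcases hN q hq hqN with h | h
    · exact h
    · exact absurd (h ▸ hqN) h7

theorem gcd_lt {N n p : ℕ} (hN : 0 < N) (hpN : p ∣ N) (hpn : ¬ p ∣ n) : N.gcd n < N := by
  refine lt_of_le_of_ne (Nat.le_of_dvd hN (Nat.gcd_dvd_left _ _)) fun h => hpn ?_
  exact (h ▸ hpN).trans (Nat.gcd_dvd_right _ _)

theorem eq_five_or_seven {q : ℕ} (hq : q.Prime) (h5 : 5 ≤ q) (h11 : q < 11) : q = 5 ∨ q = 7 := by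
  interval_cases q <;> first | exact Or.inl rfl | exact Or.inr rfl | (exfalso; revert hq; norm_num)

/-- As 2 + 7 < 11, a prime `p ≥ 11` always has a cell that meets neither `U` nor `V`, so it can be
dropped with the bounds unchanged. -/
theorem le_of_value_eq_two (he : e.IsPrimitive) (h5 : ∀ q : ℕ, q.Prime → q ∣ m → 5 ≤ q) {N : ℕ}
    (hNm : N ∣ m) {c₀ : ZMod m} {U V : ZMod m → ℕ} (hU : SupportedOn N c₀ U)
    (hV : SupportedOn N c₀ V) (hUV : value e U = value e V) (hUs : ∑ i, U i ≤ 2)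
    (hVs : ∑ i, V i ≤ 7) : U ≤ V := by
  induction N using Nat.strong_induction_on generalizing c₀ U V with
  | _ N ih =>
  by_cases h : ∃ p : ℕ, p.Prime ∧ p ∣ N ∧ 11 ≤ p
  · obtain ⟨p, hp, hpN, h11⟩ := h
    obtain ⟨k, n, hm, hpn, hcop⟩ := exists_eq_pow_mul (m := m) hp
    intro c
    by_cases hc : U c = 0
    · rw [hc]; exact Nat.zero_le _
    refine le_of_value_eq_step he (B := 1) hp hpN hNm hm hpn hU hV hUV (by omega) hc ?_
    intro A hA hAs hAv
    obtain rfl : A = 0 := eq_zero_of_sum_eq_zero (by omega)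
    rw [zero_add] at hAv ⊢
    exact ih _ (gcd_lt (Nat.pos_of_dvd_of_pos hNm (NeZero.pos m)) hpN hpn)
      ((Nat.gcd_dvd_left _ _).trans hNm) (hU.cell (hU c hc)) (hV.cell (hU c hc)) hAv
      ((sum_cell_le n c U).trans hUs) ((sum_cell_le n c V).trans hVs)
  · push Not at h
    exact le_of_value_eq_of_seven he hNm
      (fun q hq hqN => eq_five_or_seven hq (h5 q hq (hqN.trans hNm)) (h q hq hqN)) hU hV hUV hUs
      (by omega)

theorem le_of_value_eq_one (he : e.IsPrimitive) (h5 : ∀ q : ℕ, q.Prime → q ∣ m → 5 ≤ q) {N : ℕ}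
    (hNm : N ∣ m) {c₀ : ZMod m} {U V : ZMod m → ℕ} (hU : SupportedOn N c₀ U)
    (hV : SupportedOn N c₀ V) (hUV : value e U = value e V) (hUs : ∑ i, U i ≤ 1)
    (hVs : ∑ i, V i ≤ 17) : U ≤ V := by
  induction N using Nat.strong_induction_on generalizing c₀ U V with
  | _ N ih =>
  by_cases h : ∃ p : ℕ, p.Prime ∧ p ∣ N ∧ 11 ≤ p
  · obtain ⟨p, hp, hpN, h11⟩ := h
    obtain ⟨k, n, hm, hpn, hcop⟩ := exists_eq_pow_mul (m := m) hp
    intro c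
    by_cases hc : U c = 0
    · rw [hc]; exact Nat.zero_le _
    have hdvd : N.gcd n ∣ m := (Nat.gcd_dvd_left _ _).trans hNm
    by_cases hS : value e (cell n c U) = value e (cell n c V)
    · have := ih _ (gcd_lt (Nat.pos_of_dvd_of_pos hNm (NeZero.pos m)) hpN hpn) hdvd
        (hU.cell (hU c hc)) (hV.cell (hU c hc)) hS ((sum_cell_le n c U).trans hUs)
        ((sum_cell_le n c V).trans hVs) c
      rwa [cell_self, cell_self] at this
    -- 2 · 1 + 17 < 11 · 2. At most one element is added to `U`, which leads to `le_of_value_eq_two`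
    -- once the cell of `V` is known to have at most 7 elements.
    refine le_of_value_eq_step he (B := 2) hp hpN hNm hm hpn hU hV hUV (by omega) hc ?_
    intro A hA hAs hAv
    refine le_of_value_eq_two he h5 hdvd (hA.add (hU.cell (hU c hc))) (hV.cell (hU c hc)) hAv ?_ ?_
    · have := sum_cell_le n c U
      simp only [Pi.add_apply, Finset.sum_add_distrib]
      omega
    -- The difference of `U` and `V` is nonzero on this cell, hence on all `p` of them, so none is
    -- empty. Of at most 18 elements at least 10 lie in other cells and one is `c` in `U`, which
    -- leaves 7 for `V`.
    · have hall : ∀ t ∈ torsion m p,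
          1 ≤ ∑ i, cell n (c + t) U i + ∑ i, cell n (c + t) V i := by
        intro t ht
        have h1 := value_cell_sub_add he hp hm hUV (mem_torsion.1 ht) c
        by_contra hcon
        rw [eq_zero_of_sum_eq_zero (U := cell n (c + t) U) (by omega),
          eq_zero_of_sum_eq_zero (U := cell n (c + t) V) (by omega), sub_self] at h1
        rcases mul_eq_zero.1 h1.symm with h2 | h2
        · exact char_ne_zero e t h2
        · exact hS (sub_eq_zero.1 h2).symm
      have h1 := Finset.sum_le_sum fun t ht =>
        hall t ((Finset.mem_erase.1 (ht : t ∈ (torsion m p).erase 0)).2)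
      rw [Finset.sum_const, Finset.card_erase_of_mem (zero_mem_torsion p),
        card_torsion (hpN.trans hNm), smul_eq_mul, mul_one] at h1
      have h2 := Finset.add_sum_erase (torsion m p)
        (fun t => ∑ i, cell n (c + t) U i + ∑ i, cell n (c + t) V i) (zero_mem_torsion p)
      rw [Finset.sum_add_distrib (s := torsion m p)] at h2
      simp only [add_zero] at h2
      have h3 := sum_cells_le hcop c U
      have h4 := sum_cells_le hcop c V
      have h5 : cell n c U c ≤ ∑ i, cell n c U i :=
        Finset.single_le_sum (fun _ _ => Nat.zero_le _) (Finset.mem_univ c)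
      rw [cell_self] at h5
      omega
  · push Not at h
    exact le_of_value_eq_of_seven he hNm
      (fun q hq hqN => eq_five_or_seven hq (h5 q hq (hqN.trans hNm)) (h q hq hqN)) hU hV hUV
      (by omega) (by omega)

end Cells

/-! ### Prime cosets inside vanishing sums of length at most 27 -/

section Peel

variable {m : ℕ} [NeZero m] {e : AddChar (ZMod m) ℂ}

theorem SupportedOn.translate {N : ℕ} {c : ZMod m} {U : ZMod m → ℕ} (hU : SupportedOn N c U)
    (t : ZMod m) : SupportedOn N (c + t) (translate t U) := by
  intro i hi
  have := hU (i - t) hi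
  rw [← this]; ring

theorem cell_congr {n : ℕ} {c d : ZMod m} (h : (n : ZMod m) * (c - d) = 0) (U : ZMod m → ℕ) :
    cell n c U = cell n d U := by
  ext i
  unfold cell
  have : (n : ZMod m) * (i - c) = n * (i - d) := by linear_combination -h
  rw [this]

/-- If the cells of a prime `p` do not vanish, then a vanishing sum contains a full coset of the
subgroup of order `p`, provided that a smallest cell is contained in all others. -/
theorem exists_torsion_coset_of_cell (he : e.IsPrimitive) {N p k n : ℕ} (hp : p.Prime)
    (hpN : p ∣ N) (hNm : N ∣ m) (hm : m = p ^ k * n) (hpn : ¬ p ∣ n) {c₀ c : ZMod m}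
    {X : ZMod m → ℕ} (hX : SupportedOn N c₀ X) (hv : value e X = 0)
    (hc : value e (cell n c X) ≠ 0)
    (hstep : ∀ (d : ZMod m) (U V : ZMod m → ℕ), SupportedOn (N.gcd n) d U →
      SupportedOn (N.gcd n) d V → value e U = value e V → 1 ≤ ∑ i, U i →
      ∑ i, V i + (p - 1) * ∑ i, U i ≤ ∑ i, X i → ∑ i, U i ≤ ∑ i, V i → U ≤ V) :
    ∃ d, ∀ t, (p : ZMod m) * t = 0 → 1 ≤ X (d + t) := by
  have hcop : p.Coprime n := (Nat.Prime.coprime_iff_not_dvd hp).2 hpn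
  -- A smallest cell, translated by `t`, has the same value as its counterpart, so the uniqueness
  -- hypothesis `hstep` embeds it there. Any point `d` of it then has all its `p`-torsion translates
  -- in `X`.
  obtain ⟨t₀, ht₀, hmin⟩ := Finset.exists_min_image (torsion m p)
    (fun t => ∑ i, cell n (c + t) X i) ⟨0, zero_mem_torsion p⟩
  rw [mem_torsion] at ht₀
  have hval : value e (cell n (c + t₀) X) ≠ 0 := by
    rw [value_cell_add he hp hm hv ht₀ c]
    exact mul_ne_zero (char_ne_zero e t₀) hc
  have hex : ∃ d, cell n (c + t₀) X d ≠ 0 := by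
    by_contra hcon
    push Not at hcon
    exact hval (by rw [show cell n (c + t₀) X = 0 from funext hcon, value_zero])
  obtain ⟨d, hd⟩ := hex
  have hd' : (n : ZMod m) * (d - (c + t₀)) = 0 ∧ X d ≠ 0 := by
    unfold cell at hd
    split_ifs at hd with h
    · exact ⟨h, hd⟩
    · exact absurd rfl hd
  obtain ⟨hnd, hXd⟩ := hd'
  have hcell : ∀ t, cell n (d + t) X = cell n (c + (t₀ + t)) X := fun t =>
    cell_congr (by linear_combination hnd) X
  have hmin' : ∀ t, (p : ZMod m) * t = 0 → ∑ i, cell n d X i ≤ ∑ i, cell n (d + t) X i := by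
    intro t ht
    have h0 := hcell 0
    rw [add_zero, add_zero] at h0
    rw [h0, hcell t]
    exact hmin _ (by rw [mem_torsion, mul_add, ht₀, ht, add_zero])
  refine ⟨d, fun t ht => ?_⟩
  have hNd := hX d hXd
  have hNt : (N : ZMod m) * (d + t - c₀) = 0 := by
    obtain ⟨r, rfl⟩ := hpN
    push_cast at hNd ⊢
    linear_combination hNd + (r : ZMod m) * ht
  have hsum := sum_translate t (cell n d X)
  have hle := hstep (d + t) (GBF.translate t (cell n d X)) (cell n (d + t) X)
    ((hX.cell hNd).translate t) (hX.cell hNt)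
    (by rw [value_translate, value_cell_add he hp hm hv ht d])
    (by
      rw [hsum]
      refine le_trans ?_ (Finset.single_le_sum (fun _ _ => Nat.zero_le _) (Finset.mem_univ d))
      rw [cell_self]
      omega)
    (by
      rw [hsum]
      have h1 := Finset.sum_le_sum fun s hs =>
        hmin' s (mem_torsion.1 (Finset.mem_erase.1 (hs : s ∈ (torsion m p).erase t)).2)
      rw [Finset.sum_const, Finset.card_erase_of_mem (mem_torsion.2 ht),
        card_torsion (hpN.trans hNm), smul_eq_mul] at h1
      have h2 := Finset.add_sum_erase (torsion m p)
        (fun t => ∑ i, cell n (d + t) X i) (mem_torsion.2 ht)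
      have h3 := sum_cells_le hcop d X
      omega)
    (by rw [hsum]; exact hmin' t ht) (d + t)
  have h1 : GBF.translate t (cell n d X) (d + t) = X d := by
    unfold GBF.translate
    rw [add_sub_cancel_right, cell_self]
  rw [h1, cell_self] at hle
  exact (Nat.one_le_iff_ne_zero.2 hXd).trans hle

/-- If all cells of a prime vanish, one nonempty cell is a vanishing sum with a smaller `N`.
Otherwise uniqueness is needed for a smallest cell `U` and another cell `V`, with `(p - 1)|U| + |V|
≤ 27` and `|U| ≤ |V|`. For `p ≥ 11` this leaves `|U| = 1, |V| ≤ 17` or `|U| = 2, |V| ≤ 7`; for `p =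
7`, taken when only 5 and 7 occur, `|U| ≤ 3`; for `p = 5`, taken last, cells are points. -/
theorem exists_torsion_coset_le (he : e.IsPrimitive) (h5 : ∀ q : ℕ, q.Prime → q ∣ m → 5 ≤ q)
    {N : ℕ} (hNm : N ∣ m) {c₀ : ZMod m} {X : ZMod m → ℕ} (hX : SupportedOn N c₀ X)
    (hv : value e X = 0) (h0 : X ≠ 0) (hs : ∑ i, X i ≤ 27) :
    ∃ p : ℕ, p.Prime ∧ p ∣ m ∧ ∃ d, ∀ t, (p : ZMod m) * t = 0 → 1 ≤ X (d + t) := by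
  induction N using Nat.strong_induction_on generalizing c₀ X with
  | _ N ih =>
  have hrec : ∀ {p k n : ℕ}, p ∣ N → m = p ^ k * n → ¬ p ∣ n →
      (∀ c, value e (cell n c X) = 0) →
      ∃ p : ℕ, p.Prime ∧ p ∣ m ∧ ∃ d, ∀ t, (p : ZMod m) * t = 0 → 1 ≤ X (d + t) := by
    intro p k n hpN hm hpn hall
    obtain ⟨c, hc⟩ : ∃ c, X c ≠ 0 := by
      by_contra hcon
      push Not at hcon
      exact h0 (funext hcon)
    obtain ⟨q, hq, hqm, d, hd⟩ := ih _ (gcd_lt (Nat.pos_of_dvd_of_pos hNm (NeZero.pos m)) hpN hpn)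
      ((Nat.gcd_dvd_left _ _).trans hNm) (hX.cell (n := n) (hX c hc)) (hall c)
      (fun h => hc (by rw [← cell_self n c X, h]; rfl)) ((sum_cell_le n c X).trans hs)
    exact ⟨q, hq, hqm, d, fun t ht => (hd t ht).trans (cell_le n c X _)⟩
  have hmain : ∀ {p k n : ℕ}, p.Prime → p ∣ N → m = p ^ k * n → ¬ p ∣ n →
      (∀ (d : ZMod m) (U V : ZMod m → ℕ), SupportedOn (N.gcd n) d U →
      SupportedOn (N.gcd n) d V → value e U = value e V → 1 ≤ ∑ i, U i →
      ∑ i, V i + (p - 1) * ∑ i, U i ≤ ∑ i, X i → ∑ i, U i ≤ ∑ i, V i → U ≤ V) →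
      ∃ p : ℕ, p.Prime ∧ p ∣ m ∧ ∃ d, ∀ t, (p : ZMod m) * t = 0 → 1 ≤ X (d + t) := by
    intro p k n hp hpN hm hpn hstep
    by_cases hall : ∀ c, value e (cell n c X) = 0
    · exact hrec hpN hm hpn hall
    · push Not at hall
      obtain ⟨c, hc⟩ := hall
      exact ⟨p, hp, hpN.trans hNm,
        exists_torsion_coset_of_cell he hp hpN hNm hm hpn hX hv hc hstep⟩
  by_cases h : ∃ p : ℕ, p.Prime ∧ p ∣ N ∧ 11 ≤ p
  · obtain ⟨p, hp, hpN, h11⟩ := h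
    obtain ⟨k, n, hm, hpn, -⟩ := exists_eq_pow_mul (m := m) hp
    refine hmain hp hpN hm hpn fun d U V hU hV hUV h1 h2 h3 => ?_
    have h4 : 10 * ∑ i, U i ≤ (p - 1) * ∑ i, U i := Nat.mul_le_mul_right _ (by omega)
    have hdvd : N.gcd n ∣ m := (Nat.gcd_dvd_left _ _).trans hNm
    by_cases h5' : ∑ i, U i ≤ 1
    · exact le_of_value_eq_one he h5 hdvd hU hV hUV h5' (by omega)
    · exact le_of_value_eq_two he h5 hdvd hU hV hUV (by omega) (by omega)
  push Not at h
  have h57 : ∀ q : ℕ, q.Prime → q ∣ N → q = 5 ∨ q = 7 := fun q hq hqN =>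
    eq_five_or_seven hq (h5 q hq (hqN.trans hNm)) (h q hq hqN)
  by_cases h7 : 7 ∣ N
  · have hp : Nat.Prime 7 := by norm_num
    obtain ⟨k, n, hm, hpn, -⟩ := exists_eq_pow_mul (m := m) hp
    refine hmain hp h7 hm hpn fun d U V hU hV hUV h1 h2 h3 => ?_
    refine le_of_value_eq_of_five he ((Nat.gcd_dvd_left _ _).trans hNm) (fun q hq hqd => ?_)
      hU hV hUV (by omega)
    rcases h57 q hq (hqd.trans (Nat.gcd_dvd_left _ _)) with h | h
    · exact h
    · exact absurd (h ▸ hqd.trans (Nat.gcd_dvd_right _ _)) hpn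
  have hN5 : ∀ q : ℕ, q.Prime → q ∣ N → q = 5 := by
    intro q hq hqN
    rcases h57 q hq hqN with h | h
    · exact h
    · exact absurd (h ▸ hqN) h7
  by_cases hN1 : N = 1
  · subst hN1
    exfalso
    rw [hX.value_eq] at hv
    have hc : X c₀ = 0 := by
      have := (mul_eq_zero.1 hv).resolve_right (char_ne_zero e c₀)
      exact_mod_cast this
    refine h0 (funext fun i => ?_)
    by_contra hi
    exact hi (by rw [hX.eq_of_ne_zero hi, hc]; rfl)
  obtain ⟨q, hq, hqN⟩ := Nat.exists_prime_and_dvd hN1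
  obtain rfl : q = 5 := hN5 q hq hqN
  obtain ⟨k, n, hm, hpn, -⟩ := exists_eq_pow_mul (m := m) hq
  refine hmain hq hqN hm hpn fun d U V hU hV hUV h1 h2 h3 => ?_
  rw [gcd_eq_one_of_forall_prime hpn hN5] at hU hV
  exact hU.le_of_value_eq hV hUV

/-- The coset `c + {i | p * i = 0}`. -/
def torsionCoset (p : ℕ) (c : ZMod m) : ZMod m → ℕ :=
  fun i => if (p : ZMod m) * (i - c) = 0 then 1 else 0

theorem sum_torsionCoset_mul {R : Type*} [AddCommMonoid R] (p : ℕ) (c : ZMod m)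
    (φ : ZMod m → R) : ∑ i, torsionCoset p c i • φ i = ∑ t ∈ torsion m p, φ (c + t) := by
  rw [← Equiv.sum_comp (Equiv.addLeft c), torsion, Finset.sum_filter]
  refine Finset.sum_congr rfl fun t _ => ?_
  simp only [torsionCoset, Equiv.coe_addLeft, add_sub_cancel_left]
  split_ifs <;> simp

theorem sum_torsionCoset {p : ℕ} (hp : p ∣ m) (c : ZMod m) : ∑ i, torsionCoset p c i = p := by
  have := sum_torsionCoset_mul p c (fun _ => (1 : ℕ))
  simpa [card_torsion hp] using this

theorem value_torsionCoset (he : e.IsPrimitive) {p : ℕ} (hp : p ∣ m) (hp1 : p ≠ 1) (c : ZMod m) :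
    value e (torsionCoset p c) = 0 := by
  have := sum_torsionCoset_mul p c (fun i => e i)
  simp_rw [AddChar.map_add_eq_mul, ← Finset.mul_sum, sum_torsion_char he hp hp1, mul_zero] at this
  simpa [value] using this

theorem exists_eq_torsionCoset_add (he : e.IsPrimitive) (h5 : ∀ q : ℕ, q.Prime → q ∣ m → 5 ≤ q)
    {X : ZMod m → ℕ} (hv : value e X = 0) (h0 : X ≠ 0) (hs : ∑ i, X i ≤ 27) :
    ∃ p : ℕ, p.Prime ∧ p ∣ m ∧ ∃ (c : ZMod m) (Y : ZMod m → ℕ), X = torsionCoset p c + Y ∧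
      value e Y = 0 ∧ ∑ i, X i = p + ∑ i, Y i := by
  obtain ⟨p, hp, hpm, c, hc⟩ := exists_torsion_coset_le he h5 (dvd_refl m) (c₀ := 0)
    (fun i _ => by simp) hv h0 hs
  have hX : X = torsionCoset p c + fun i => X i - torsionCoset p c i := by
    funext i
    rw [Pi.add_apply, Nat.add_sub_cancel']
    unfold torsionCoset
    split_ifs with h
    · have := hc (i - c) h
      rwa [add_sub_cancel] at this
    · exact Nat.zero_le _
  refine ⟨p, hp, hpm, c, _, hX, ?_, ?_⟩
  · rw [hX, value_add, value_torsionCoset he hpm hp.ne_one, zero_add] at hv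
    exact hv
  · conv_lhs => rw [hX]
    simp only [Pi.add_apply, Finset.sum_add_distrib, sum_torsionCoset hpm]

/-- The sizes of small vanishing sums are sums of primes `≥ 5`. -/
theorem size_ne (he : e.IsPrimitive) (h5 : ∀ q : ℕ, q.Prime → q ∣ m → 5 ≤ q)
    {X : ZMod m → ℕ} (hv : value e X = 0) (hs : ∑ i, X i < 10) (h0 : ∑ i, X i ≠ 0) :
    ∑ i, X i = 5 ∨ ∑ i, X i = 7 := by
  obtain ⟨p, hp, hpm, c, Y, -, hY, hsum⟩ := exists_eq_torsionCoset_add he h5 hv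
    (fun h => h0 (by simp [h])) (by omega)
  have hp5 := h5 p hp hpm
  have hYs : ∑ i, Y i = 0 := by
    by_contra hY0
    obtain ⟨q, hq, hqm, -, Z, -, -, hsum'⟩ := exists_eq_torsionCoset_add he h5 hY
      (fun h => hY0 (by simp [h])) (by omega)
    have := h5 q hq hqm
    omega
  have := eq_five_or_seven hp hp5 (by omega)
  omega

theorem eq_torsionCoset_of_size_five (he : e.IsPrimitive)
    (h5 : ∀ q : ℕ, q.Prime → q ∣ m → 5 ≤ q) {X : ZMod m → ℕ} (hv : value e X = 0)
    (hs : ∑ i, X i = 5) : ∃ c, X = torsionCoset 5 c := by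
  obtain ⟨p, hp, hpm, c, Y, hX, hY, hsum⟩ := exists_eq_torsionCoset_add he h5 hv
    (fun h => by simp [h] at hs) (by omega)
  have hp5 := h5 p hp hpm
  obtain rfl : p = 5 := by omega
  exact ⟨c, by rw [hX, eq_zero_of_sum_eq_zero (U := Y) (by omega), add_zero]⟩

theorem prime_cases {p : ℕ} (hp : p.Prime) (h5 : 5 ≤ p) (h16 : p ≤ 16) :
    p = 5 ∨ p = 7 ∨ p = 11 ∨ p = 13 := by
  interval_cases p <;> first | decide | (exfalso; revert hp; norm_num)

theorem eq_torsionCoset_of_size_eleven (he : e.IsPrimitive)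
    (h5 : ∀ q : ℕ, q.Prime → q ∣ m → 5 ≤ q) {X : ZMod m → ℕ} (hv : value e X = 0)
    (hs : ∑ i, X i = 11) : ∃ c, X = torsionCoset 11 c := by
  obtain ⟨p, hp, hpm, c, Y, hX, hY, hsum⟩ := exists_eq_torsionCoset_add he h5 hv
    (fun h => by simp [h] at hs) (by omega)
  have hp5 := h5 p hp hpm
  have hsz := size_ne he h5 hY (by omega)
  have hpc := prime_cases hp hp5 (by omega)
  obtain rfl : p = 11 := by omega
  exact ⟨c, by rw [hX, eq_zero_of_sum_eq_zero (U := Y) (by omega), add_zero]⟩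

/-- A first coset of order 7 or 13 would leave 9 or 3 roots, and no vanishing sum has such a size.
-/
theorem eq_torsionCoset_of_size_sixteen (he : e.IsPrimitive)
    (h5 : ∀ q : ℕ, q.Prime → q ∣ m → 5 ≤ q) {X : ZMod m → ℕ} (hv : value e X = 0)
    (hs : ∑ i, X i = 16) : ∃ c d, X = torsionCoset 5 c + torsionCoset 11 d := by
  obtain ⟨p, hp, hpm, c, Y, hX, hY, hsum⟩ := exists_eq_torsionCoset_add he h5 hv
    (fun h => by simp [h] at hs) (by omega)
  have hp5 := h5 p hp hpm
  have hsz := size_ne he h5 hY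
  rcases prime_cases hp hp5 (by omega) with rfl | rfl | rfl | rfl
  · obtain ⟨d, hd⟩ := eq_torsionCoset_of_size_eleven he h5 hY (by omega)
    exact ⟨c, d, by rw [hX, hd]⟩
  · omega
  · obtain ⟨d, hd⟩ := eq_torsionCoset_of_size_five he h5 hY (by omega)
    exact ⟨d, c, by rw [hX, hd, add_comm]⟩
  · omega

end Peel

/-! ### Translation between ℕ[C_m] and functions on Z/m -/

section GroupSemiring

variable {m : ℕ} [NeZero m]

/-- The coefficients of an element of `ℕ[C_m]` as a function on `ℤ/m`. -/
def coeffFun (X : NC m) : ZMod m → ℕ := fun i => X.coeff (Multiplicative.ofAdd i)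

/-- The element of `ℕ[C_m]` with given coefficients. -/
noncomputable def ofFun (F : ZMod m → ℕ) : NC m :=
  MonoidAlgebra.ofCoeff
    (Finsupp.equivFunOnFinite.symm fun c : C m => F (Multiplicative.toAdd c))

@[simp] theorem coeffFun_ofFun (F : ZMod m → ℕ) : coeffFun (ofFun F) = F := by
  ext i
  simp [coeffFun, ofFun]

theorem coeffFun_injective : Function.Injective (coeffFun : NC m → ZMod m → ℕ) := by
  intro X Y h
  ext c
  exact congrFun h (Multiplicative.toAdd c)

@[simp] theorem coeffFun_add (X Y : NC m) : coeffFun (X + Y) = coeffFun X + coeffFun Y := by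
  ext i
  simp [coeffFun, MonoidAlgebra.coeff_add]

@[simp] theorem coeffFun_zero : coeffFun (0 : NC m) = 0 := rfl

theorem coeffFun_sum {ι : Type*} (s : Finset ι) (X : ι → NC m) :
    coeffFun (∑ j ∈ s, X j) = ∑ j ∈ s, coeffFun (X j) := by
  classical
  induction s using Finset.induction_on with
  | empty => simp
  | insert a s ha ih => rw [Finset.sum_insert ha, Finset.sum_insert ha, coeffFun_add, ih]

theorem coeffFun_gpow (k : ZMod m) : coeffFun (gpow k) = fun i => if i = k then 1 else 0 := by
  ext i
  simp only [coeffFun, gpow, MonoidAlgebra.coeff_single, Finsupp.single_apply]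
  simp [eq_comm]

theorem gpow_mul_gpow (k l : ZMod m) : gpow k * gpow l = (gpow (k + l) : NC m) := by
  simp [gpow, MonoidAlgebra.single_mul_single]

theorem D_eq_sum_gpow (t : ℕ) : D m t = ∑ k ∈ torsion m t, gpow k := by
  unfold D torsion
  rw [Finset.sum_filter, Finset.sum_filter]
  refine Fintype.sum_equiv Multiplicative.toAdd _ _ fun d => ?_
  have : d ^ t = 1 ↔ (t : ZMod m) * Multiplicative.toAdd d = 0 := by
    rw [← nsmul_eq_mul, ← toAdd_pow]
    exact Iff.rfl
  simp only [this]
  rfl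

theorem D_mul_gpow (t : ℕ) (c : ZMod m) : D m t * gpow c = ∑ k ∈ torsion m t, gpow (c + k) := by
  rw [D_eq_sum_gpow, Finset.sum_mul]
  exact Finset.sum_congr rfl fun k _ => by rw [gpow_mul_gpow, add_comm]

theorem coeffFun_D_mul_gpow (t : ℕ) (c : ZMod m) :
    coeffFun (D m t * gpow c) = torsionCoset t c := by
  rw [D_mul_gpow, coeffFun_sum]
  ext i
  rw [Finset.sum_apply, ← sum_torsionCoset_mul t c (fun k => coeffFun (gpow k) i)]
  simp [coeffFun_gpow]

/-- The additive extension of a function on `ℤ/m` to `ℕ[C_m]`. -/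
def extend {R : Type*} [AddCommMonoid R] (φ : ZMod m → R) (X : NC m) : R :=
  ∑ i, coeffFun X i • φ i

theorem extend_add {R : Type*} [AddCommMonoid R] (φ : ZMod m → R) (X Y : NC m) :
    extend φ (X + Y) = extend φ X + extend φ Y := by
  simp [extend, add_smul, Finset.sum_add_distrib]

theorem extend_gpow {R : Type*} [AddCommMonoid R] (φ : ZMod m → R) (k : ZMod m) :
    extend φ (gpow k) = φ k := by
  simp [extend, coeffFun_gpow]

theorem extend_sum {R : Type*} [AddCommMonoid R] (φ : ZMod m → R) {ι : Type*} (s : Finset ι)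
    (X : ι → NC m) : extend φ (∑ j ∈ s, X j) = ∑ j ∈ s, extend φ (X j) := by
  classical
  induction s using Finset.induction_on with
  | empty => simp [extend]
  | insert a s ha ih => rw [Finset.sum_insert ha, Finset.sum_insert ha, extend_add, ih]

theorem extend_D_mul_gpow {R : Type*} [AddCommMonoid R] (φ : ZMod m → R) (t : ℕ) (c : ZMod m) :
    extend φ (D m t * gpow c) = ∑ k ∈ torsion m t, φ (c + k) := by
  rw [D_mul_gpow, extend_sum]
  exact Finset.sum_congr rfl fun k _ => extend_gpow φ _

end GroupSemiring

/-! ### Minimal v-sums, reduced exponents and the c-exponent -/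

section Exponent

variable {m : ℕ} [NeZero m] {ζ : ℂ}

/-- The character of `ℤ/m` that takes the value `ζ` at `1`. -/
noncomputable def rootChar (hζ : IsPrimitiveRoot ζ m) : AddChar (ZMod m) ℂ :=
  AddChar.zmodChar m hζ.pow_eq_one

theorem rootChar_apply (hζ : IsPrimitiveRoot ζ m) (i : ZMod m) : rootChar hζ i = ζ ^ i.val := rfl

theorem rootChar_isPrimitive (hζ : IsPrimitiveRoot ζ m) : (rootChar hζ).IsPrimitive :=
  AddChar.zmodChar_primitive_of_primitive_root m hζ

theorem root_eq (hζ : IsPrimitiveRoot ζ m) (c : C m) :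
    root ζ c = rootChar hζ (Multiplicative.toAdd c) := rfl

theorem isVSum_iff (hζ : IsPrimitiveRoot ζ m) (X : NC m) :
    IsVSum ζ X ↔ value (rootChar hζ) (coeffFun X) = 0 := by
  have : ∑ c ∈ X.coeff.support, (X.coeff c : ℂ) * root ζ c =
      value (rootChar hζ) (coeffFun X) := by
    unfold value
    rw [← Equiv.sum_comp Multiplicative.toAdd]
    refine Finset.sum_subset (Finset.subset_univ _) fun c _ hc => ?_
    rw [Finsupp.notMem_support_iff] at hc
    rw [hc]; simp
  rw [IsVSum, this]

/-- This keeps the infimum in `cExponent` from being the default `sInf ∅ = 0`, which 11 would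
divide: the minimum is attained. -/
theorem exists_isDecomposition (hζ : IsPrimitiveRoot ζ m) (X : NC m) (hX : IsVSum ζ X) :
    ∃ s, IsDecomposition ζ X s := by
  induction hn : ∑ i, coeffFun X i using Nat.strong_induction_on generalizing X with
  | _ n ih =>
  by_cases h0 : X = 0
  · exact ⟨0, by simp, by simp [h0]⟩
  by_cases hmin : IsMinimalVSum ζ X
  · exact ⟨{X}, by simpa using hmin, by simp⟩
  have hY : ∃ Y : NC m, (∀ c, Y.coeff c ≤ X.coeff c) ∧ Y ≠ 0 ∧ Y ≠ X ∧ IsVSum ζ Y := by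
    by_contra hcon
    push Not at hcon
    exact hmin ⟨h0, hX, fun Y h1 h2 h3 => hcon Y h1 h2 h3⟩
  obtain ⟨Y, hle, hY0, hYX, hYv⟩ := hY
  set Z : NC m := ofFun fun i => coeffFun X i - coeffFun Y i with hZ
  have hXYZ : X = Y + Z := by
    apply coeffFun_injective
    ext i
    rw [coeffFun_add, hZ, coeffFun_ofFun, Pi.add_apply]
    exact (Nat.add_sub_cancel' (hle (Multiplicative.ofAdd i))).symm
  have hpos : ∀ W : NC m, W ≠ 0 → 0 < ∑ i, coeffFun W i := by
    intro W hW
    rw [Nat.pos_iff_ne_zero]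
    intro h
    exact hW (coeffFun_injective (eq_zero_of_sum_eq_zero h))
  have hsum : ∑ i, coeffFun X i = ∑ i, coeffFun Y i + ∑ i, coeffFun Z i := by
    rw [← Finset.sum_add_distrib]
    conv_lhs => rw [hXYZ]
    simp
  have hZ0 : Z ≠ 0 := fun h => hYX (by rw [hXYZ, h, add_zero])
  have hZv : IsVSum ζ Z := by
    rw [isVSum_iff hζ] at hX hYv ⊢
    rw [hXYZ, coeffFun_add, value_add, hYv, zero_add] at hX
    exact hX
  have h1 := hpos Y hY0
  have h2 := hpos Z hZ0
  obtain ⟨s, hs, hsY⟩ := ih _ (by omega) Y hYv rfl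
  obtain ⟨s', hs', hsZ⟩ := ih _ (by omega) Z hZv rfl
  refine ⟨s + s', fun W hW => ?_, by rw [Multiset.sum_add, hsY, hsZ, ← hXYZ]⟩
  rcases Multiset.mem_add.1 hW with h | h
  · exact hs W h
  · exact hs' W h

/-- Minimal vanishing sums of size at most 27 are cosets of subgroups of prime order. -/
theorem IsMinimalVSum.eq_D_mul_gpow (hζ : IsPrimitiveRoot ζ m)
    (h5 : ∀ q : ℕ, q.Prime → q ∣ m → 5 ≤ q) {Y : NC m} (hY : IsMinimalVSum ζ Y)
    (hs : ∑ i, coeffFun Y i ≤ 27) :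
    ∃ p : ℕ, p.Prime ∧ p ∣ m ∧ ∃ c, Y = D m p * gpow c := by
  obtain ⟨hY0, hYv, hmin⟩ := hY
  rw [isVSum_iff hζ] at hYv
  obtain ⟨p, hp, hpm, c, Z, hYZ, -, -⟩ :=
    exists_eq_torsionCoset_add (rootChar_isPrimitive hζ) h5 hYv
      (fun h => hY0 (coeffFun_injective h)) hs
  refine ⟨p, hp, hpm, c, ?_⟩
  by_contra hne
  refine hmin (D m p * gpow c) (fun d => ?_) (fun h => ?_) (Ne.symm hne) ?_
  · have h1 : coeffFun (D m p * gpow c) ≤ coeffFun Y := by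
      rw [coeffFun_D_mul_gpow, hYZ]
      exact fun i => Nat.le_add_right _ _
    exact h1 (Multiplicative.toAdd d)
  · have h1 := sum_torsionCoset hpm c
    rw [← coeffFun_D_mul_gpow, h] at h1
    simp only [coeffFun_zero, Pi.zero_apply, Finset.sum_const_zero] at h1
    exact hp.ne_zero h1.symm
  · rw [isVSum_iff hζ, coeffFun_D_mul_gpow]
    exact value_torsionCoset (rootChar_isPrimitive hζ) hpm hp.ne_one c

theorem root_mul_inv_pow_eq_one_iff (hζ : IsPrimitiveRoot ζ m) (i j : C m) (r : ℕ) :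
    (root ζ i * (root ζ j)⁻¹) ^ r = 1 ↔
      (r : ZMod m) * (Multiplicative.toAdd i - Multiplicative.toAdd j) = 0 := by
  have h1 : root ζ i * (root ζ j)⁻¹ =
      rootChar hζ (Multiplicative.toAdd i - Multiplicative.toAdd j) := by
    rw [root_eq hζ, root_eq hζ, mul_inv_eq_iff_eq_mul₀ (char_ne_zero _ _),
      ← AddChar.map_add_eq_mul, sub_add_cancel]
  rw [h1, ← AddChar.map_nsmul_eq_pow, (rootChar_isPrimitive hζ).zmod_char_eq_one_iff,
    nsmul_eq_mul]

theorem reducedExponent_D_mul_gpow (hζ : IsPrimitiveRoot ζ m) {p : ℕ} (hp : p.Prime)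
    (hpm : p ∣ m) (c : ZMod m) : reducedExponent ζ (D m p * gpow c) = p := by
  have hmem : ∀ d : C m, d ∈ (D m p * gpow c : NC m).coeff.support ↔
      (p : ZMod m) * (Multiplicative.toAdd d - c) = 0 := by
    intro d
    have h1 := congrFun (coeffFun_D_mul_gpow p c) (Multiplicative.toAdd d)
    have h2 : (D m p * gpow c : NC m).coeff d = torsionCoset p c (Multiplicative.toAdd d) := h1
    rw [Finsupp.mem_support_iff, h2, torsionCoset]
    split_ifs with h <;> simp [h]
  set S := {r : ℕ | 0 < r ∧ ∃ j ∈ (D m p * gpow c : NC m).coeff.support,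
    ∀ i ∈ (D m p * gpow c : NC m).coeff.support, (root ζ i * (root ζ j)⁻¹) ^ r = 1} with hS
  have hpS : p ∈ S := by
    refine ⟨hp.pos, Multiplicative.ofAdd c, (hmem _).2 (by simp), fun i hi => ?_⟩
    rw [root_mul_inv_pow_eq_one_iff hζ]
    exact (hmem i).1 hi
  have hle : sInf S ≤ p := Nat.sInf_le hpS
  obtain ⟨hpos, j, hj, hall⟩ := Nat.sInf_mem ⟨p, hpS⟩
  -- Every `p`-torsion element occurs as a difference from `j`; an exponent prime to `p` would kill
  -- only the zero one.
  have hdvd : p ∣ sInf S := by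
    by_contra hnd
    have hcop : p.Coprime (sInf S) := (Nat.Prime.coprime_iff_not_dvd hp).2 hnd
    have h1 : ∀ t ∈ torsion m p, t = 0 := by
      intro t ht
      rw [mem_torsion] at ht
      refine eq_zero_of_coprime_mul hcop ht ?_
      have h2 := hall (Multiplicative.ofAdd (Multiplicative.toAdd j + t)) ((hmem _).2 (by
        have := (hmem j).1 hj
        rw [toAdd_ofAdd]
        linear_combination this + ht))
      rw [root_mul_inv_pow_eq_one_iff hζ, toAdd_ofAdd, add_sub_cancel_left] at h2
      exact h2
    have h3 : torsion m p ⊆ {0} := fun t ht => Finset.mem_singleton.2 (h1 t ht)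
    have h4 := Finset.card_le_card h3
    rw [card_torsion hpm, Finset.card_singleton] at h4
    exact absurd hp.two_le (by omega)
  exact le_antisymm hle (Nat.le_of_dvd hpos hdvd)

theorem prime_dvd_multiset_lcm {p : ℕ} (hp : p.Prime) {s : Multiset ℕ} (h : p ∣ s.lcm) :
    ∃ a ∈ s, p ∣ a := by
  have h1 : s.lcm ∣ s.prod := Multiset.lcm_dvd.2 fun a ha => Multiset.dvd_prod ha
  exact hp.prime.exists_mem_multiset_dvd (h.trans h1)

/-- A vanishing sum of size 27 whose `c`-exponent is divisible by 11 is composed of one coset of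
the subgroup of order 5 and two cosets of the subgroup of order 11. -/
theorem exists_eq_of_eleven_dvd_cExponent (hζ : IsPrimitiveRoot ζ m)
    (h5 : ∀ q : ℕ, q.Prime → q ∣ m → 5 ≤ q) {X : NC m} (hX : IsVSum ζ X)
    (hs : ∑ i, coeffFun X i = 27) (h11 : 11 ∣ cExponent ζ X) :
    ∃ a b c : ZMod m, X = D m 5 * gpow a + D m 11 * (gpow b + gpow c) := by
  obtain ⟨s₀, hs₀⟩ := exists_isDecomposition hζ X hX
  obtain ⟨s, ⟨hmin, hsum⟩, hk⟩ := Nat.sInf_mem (s := {k : ℕ | ∃ s : Multiset (NC m),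
    IsDecomposition ζ X s ∧ k = (s.map (reducedExponent ζ)).lcm}) ⟨_, s₀, hs₀, rfl⟩
  rw [cExponent, hk] at h11
  obtain ⟨r, hr, h11r⟩ := prime_dvd_multiset_lcm (by norm_num) h11
  obtain ⟨Y, hY, rfl⟩ := Multiset.mem_map.1 hr
  obtain ⟨s', rfl⟩ := Multiset.exists_cons_of_mem hY
  rw [Multiset.sum_cons] at hsum
  have hsum' : ∑ i, coeffFun Y i + ∑ i, coeffFun s'.sum i = 27 := by
    rw [← hs, ← hsum, coeffFun_add, ← Finset.sum_add_distrib]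
    rfl
  have hYmin := hmin Y hY
  obtain ⟨p, hp, hpm, b, rfl⟩ := hYmin.eq_D_mul_gpow hζ h5 (by omega)
  rw [reducedExponent_D_mul_gpow hζ hp hpm] at h11r
  obtain rfl : 11 = p := (Nat.prime_dvd_prime_iff_eq (by norm_num) hp).1 h11r
  rw [coeffFun_D_mul_gpow, sum_torsionCoset hpm] at hsum'
  have hv : value (rootChar hζ) (coeffFun s'.sum) = 0 := by
    have h1 := (isVSum_iff hζ X).1 hX
    have h2 := (isVSum_iff hζ _).1 hYmin.2.1
    rwa [← hsum, coeffFun_add, value_add, h2, zero_add] at h1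
  obtain ⟨a, c, hac⟩ := eq_torsionCoset_of_size_sixteen (rootChar_isPrimitive hζ) h5 hv (by omega)
  refine ⟨a, b, c, ?_⟩
  have h3 : s'.sum = D m 5 * gpow a + D m 11 * gpow c := by
    apply coeffFun_injective
    rw [hac, coeffFun_add, coeffFun_D_mul_gpow, coeffFun_D_mul_gpow]
  rw [← hsum, h3, mul_add]
  abel

end Exponent

/-! ### Autocorrelations of a generalized bent function -/

section Autocorrelation

/-- A flat power spectrum is the Fourier transform of an autocorrelation supported at 0: weight the
bent condition by `χ (-x)` and sum over `χ`. -/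
theorem sum_rootChar_sub_eq_zero {G : Type*} [AddCommGroup G] [Fintype G] {m : ℕ} [NeZero m]
    {ζ : ℂ} (hζ : IsPrimitiveRoot ζ m) {f : G → ZMod m} (hf : IsGBF ζ f) {x : G} (hx : x ≠ 0) :
    ∑ y, rootChar hζ (f (x + y) - f y) = 0 := by
  classical
  set e := rootChar hζ with he
  have hcard : (Fintype.card G : ℂ) ≠ 0 := Nat.cast_ne_zero.2 Fintype.card_ne_zero
  have h1 : ∀ χ : AddChar G ℂ,
      ∑ y, ∑ y', e (f y - f y') * χ (y - y') = Fintype.card G := by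
    intro χ
    have h2 := hf χ
    have h3 : ((‖∑ y : G, ζ ^ (f y).val * χ y‖ ^ 2 : ℝ) : ℂ) = (Fintype.card G : ℂ) := by
      rw [h2]; simp
    rw [← h3]
    push_cast
    rw [← Complex.mul_conj', map_sum, Finset.sum_mul_sum]
    refine Finset.sum_congr rfl fun y _ => Finset.sum_congr rfl fun y' _ => ?_
    rw [map_mul, sub_eq_add_neg, sub_eq_add_neg, AddChar.map_add_eq_mul, AddChar.map_add_eq_mul,
      AddChar.map_neg_eq_conj, AddChar.map_neg_eq_conj, he, rootChar_apply, rootChar_apply]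
    ring
  have h4 : ∑ χ : AddChar G ℂ, χ (-x) * ∑ y, ∑ y', e (f y - f y') * χ (y - y') = 0 := by
    simp_rw [h1]
    rw [← Finset.sum_mul, AddChar.sum_apply_eq_ite, if_neg (neg_ne_zero.2 hx), zero_mul]
  have h5 : ∑ χ : AddChar G ℂ, χ (-x) * ∑ y, ∑ y', e (f y - f y') * χ (y - y') =
      Fintype.card G * ∑ y', e (f (x + y') - f y') := by
    simp_rw [Finset.mul_sum]
    rw [Finset.sum_comm]
    simp_rw [Finset.sum_comm (s := (Finset.univ : Finset (AddChar G ℂ)))]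
    rw [Finset.sum_comm]
    refine Finset.sum_congr rfl fun y' _ => ?_
    have h6 : ∀ y, ∑ χ : AddChar G ℂ, χ (-x) * (e (f y - f y') * χ (y - y')) =
        if y = x + y' then (Fintype.card G : ℂ) * e (f y - f y') else 0 := by
      intro y
      have h7 : ∀ χ : AddChar G ℂ, χ (-x) * (e (f y - f y') * χ (y - y')) =
          e (f y - f y') * χ (y - (x + y')) := by
        intro χ
        rw [show y - (x + y') = -x + (y - y') by abel, AddChar.map_add_eq_mul]
        ring
      simp_rw [h7]
      rw [← Finset.mul_sum, AddChar.sum_apply_eq_ite]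
      simp only [sub_eq_zero]
      split_ifs <;> simp [mul_comm]
    simp_rw [h6]
    rw [Finset.sum_ite_eq' Finset.univ (x + y')]
    simp
  rw [h5] at h4
  exact (mul_eq_zero.1 h4).resolve_left hcard

variable {G : Type*} [AddCommGroup G] [Fintype G] {m : ℕ} [NeZero m]

theorem extend_autocorr {R : Type*} [AddCommMonoid R] (φ : ZMod m → R) (f : G → ZMod m) (x : G) :
    extend φ (autocorr f x) = ∑ y, φ (f (x + y) - f y) := by
  rw [autocorr, extend_sum]
  exact Finset.sum_congr rfl fun y _ => extend_gpow φ _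

theorem sum_coeffFun_autocorr (f : G → ZMod m) (x : G) :
    ∑ i, coeffFun (autocorr f x) i = Fintype.card G := by
  have := extend_autocorr (fun _ => (1 : ℕ)) f x
  simpa [extend] using this

theorem value_eq_extend (e : AddChar (ZMod m) ℂ) (X : NC m) :
    value e (coeffFun X) = extend (fun i => e i) X := by
  simp [value, extend]

theorem isVSum_autocorr {ζ : ℂ} (hζ : IsPrimitiveRoot ζ m) {f : G → ZMod m} (hf : IsGBF ζ f)
    {x : G} (hx : x ≠ 0) : IsVSum ζ (autocorr f x) := by
  rw [isVSum_iff hζ, value_eq_extend, extend_autocorr]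
  exact sum_rootChar_sub_eq_zero hζ hf hx

/-- The autocorrelations of `f` also vanish at the roots of the cyclotomic polynomial in other
rings. -/
theorem sum_pow_val_autocorr_eq_zero {ζ : ℂ} (hζ : IsPrimitiveRoot ζ m) {f : G → ZMod m}
    (hf : IsGBF ζ f) {x : G} (hx : x ≠ 0) {R : Type*} [CommRing R] {z : R}
    (hz : (Polynomial.cyclotomic m R).IsRoot z) : ∑ y, z ^ (f (x + y) - f y).val = 0 := by
  rw [← extend_autocorr (fun i => z ^ i.val)]
  have h1 := (isVSum_iff hζ _).1 (isVSum_autocorr hζ hf hx)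
  have h2 := sum_pow_val_eq_zero (rootChar_isPrimitive hζ)
    (a := fun i => (coeffFun (autocorr f x) i : ℤ)) (by simpa [value] using h1) hz
  simpa [extend] using h2

end Autocorrelation

/-! ### The contradiction from two exceptional points -/

section Lines

variable {G : Type*} [AddCommGroup G] [Fintype G]

/-- A function with vanishing autocorrelations is not invariant up to two exceptional points on
different lines. -/
theorem not_two_exceptional_points (h3 : ∀ y : G, y + y + y = 0) {K : Type*} [Field K]
    (hK : (2 : K) ≠ 0) {u u' : G → K} (huu : ∀ y z, u y = u z ↔ u' y = u' z)
    (hR : ∀ w, w ≠ 0 → ∑ y, u (w + y) * u' y = 0) {x e₁ e₂ : G} (hx : x ≠ 0)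
    (h0 : e₁ - e₂ ≠ 0) (hp : e₁ - e₂ ≠ x) (hn : e₁ - e₂ ≠ -x)
    (hinv : ∀ y, y ≠ e₁ → y ≠ e₁ + x → y ≠ e₂ → y ≠ e₂ + x → u y = u (y - x))
    (hd₁ : u e₁ ≠ u (e₁ - x)) (hd₂ : u e₂ ≠ u (e₂ - x))
    (hs₁ : u (e₁ + x) = u (e₁ - x)) (hs₂ : u (e₂ + x) = u (e₂ - x)) : False := by
  classical
  set w := e₁ - e₂ with hw
  have hneg : ∀ v : G, v + v = -v := fun v => eq_neg_of_add_eq_zero_left (h3 v)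
  -- With R the correlation of `u` and `u'`, this sum is 2R(w) - R(w+x) - R(w-x), and none of the
  -- three shifts is 0.
  have hsum : ∑ y, (u (w + y) - u (w + y - x)) * (u' y - u' (y - x)) = 0 := by
    have r1 := hR w h0
    have r2 := hR (w + x) (fun h => hn (eq_neg_of_add_eq_zero_left h))
    have r3 := hR (w - x) (fun h => hp (sub_eq_zero.1 h))
    have s1 : ∑ y, u (w + y) * u' (y - x) = 0 := by
      rw [← Equiv.sum_comp (Equiv.addRight x), ← r2]
      refine Finset.sum_congr rfl fun y _ => ?_
      simp only [Equiv.coe_addRight, add_sub_cancel_right]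
      rw [show w + (y + x) = w + x + y by abel]
    have s2 : ∑ y, u (w + y - x) * u' y = 0 := by
      rw [← r3]
      refine Finset.sum_congr rfl fun y _ => ?_
      rw [show w + y - x = w - x + y by abel]
    have s3 : ∑ y, u (w + y - x) * u' (y - x) = 0 := by
      rw [← Equiv.sum_comp (Equiv.addRight x), ← r1]
      refine Finset.sum_congr rfl fun y _ => ?_
      simp only [Equiv.coe_addRight, add_sub_cancel_right]
      rw [show w + (y + x) - x = w + y by abel]
    have : ∀ y, (u (w + y) - u (w + y - x)) * (u' y - u' (y - x)) =
        u (w + y) * u' y - u (w + y) * u' (y - x) - u (w + y - x) * u' y +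
          u (w + y - x) * u' (y - x) := fun y => by ring
    simp_rw [this]
    rw [Finset.sum_add_distrib, Finset.sum_sub_distrib, Finset.sum_sub_distrib, r1, s1, s2, s3]
    ring
  have hne : e₂ ≠ e₂ + x := fun h => hx (by simpa using h.symm)
  -- The differences live on `e₁, e₁ + x, e₂, e₂ + x`. Since `2w = -w`, the shift by `w` moves the
  -- first two to a third line of direction `x`, so only the last two contribute.
  have hz : ∀ y, y ∉ ({e₂, e₂ + x} : Finset G) →
      (u (w + y) - u (w + y - x)) * (u' y - u' (y - x)) = 0 := by
    intro y hy
    simp only [Finset.mem_insert, Finset.mem_singleton, not_or] at hy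
    by_cases hy1 : y = e₁
    · have : u (w + y) = u (w + y - x) := by
        refine hinv _ ?_ ?_ ?_ ?_ <;> intro h <;> subst hy1
        · exact h0 (by simpa using h)
        · exact hp (add_right_cancel (h.trans (add_comm _ _)))
        · have h' : w + w = 0 := by rw [hw] at h ⊢; rw [← sub_eq_zero] at h; rw [← h]; abel
          exact h0 (neg_eq_zero.1 ((hneg w).symm.trans h'))
        · have h' : w + w = x := by
            rw [hw] at h ⊢; rw [← sub_eq_zero] at h ⊢; rw [← h]; abel
          exact hn (neg_eq_iff_eq_neg.1 ((hneg w).symm.trans h'))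
      rw [this, sub_self, zero_mul]
    by_cases hy2 : y = e₁ + x
    · have : u (w + y) = u (w + y - x) := by
        refine hinv _ ?_ ?_ ?_ ?_ <;> intro h <;> subst hy2
        · exact hn (by rw [← sub_eq_zero] at h ⊢; rw [← h]; abel)
        · exact h0 (by simpa using h)
        · have h' : w + w = -x := by
            rw [hw] at h ⊢; rw [← sub_eq_zero] at h ⊢; rw [← h]; abel
          exact hp (neg_injective ((hneg w).symm.trans h'))
        · have h' : w + w = 0 := by rw [hw] at h ⊢; rw [← sub_eq_zero] at h; rw [← h]; abel
          exact h0 (neg_eq_zero.1 ((hneg w).symm.trans h'))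
      rw [this, sub_self, zero_mul]
    rw [(huu _ _).1 (hinv y hy1 hy2 hy.1 hy.2), sub_self, mul_zero]
  rw [← Finset.sum_subset (Finset.subset_univ {e₂, e₂ + x}) (fun y _ hy => hz y hy),
    Finset.sum_pair hne] at hsum
  have t1 : w + e₂ = e₁ := by rw [hw]; abel
  have t2 : w + (e₂ + x) = e₁ + x := by rw [hw]; abel
  rw [t1, t2, add_sub_cancel_right, add_sub_cancel_right, hs₁, (huu _ _).1 hs₂] at hsum
  -- At `e + x` each difference is minus the one at `e`, so both terms are the same product.
  have : 2 * ((u e₁ - u (e₁ - x)) * (u' e₂ - u' (e₂ - x))) = 0 := by linear_combination hsum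
  rcases mul_eq_zero.1 this with h | h
  · exact hK h
  rcases mul_eq_zero.1 h with h | h
  · exact hd₁ (sub_eq_zero.1 h)
  · exact hd₂ ((huu _ _).2 (sub_eq_zero.1 h))

end Lines

/-! ### Counting zero-sum triples on lines -/

section Triples

variable {G : Type*} [AddCommGroup G] [Fintype G] [DecidableEq G] {A : Type*} [AddCommGroup A]
  [DecidableEq A]

theorem sum_comp_add {M : Type*} [AddCommMonoid M] (φ : G → M) (x : G) :
    ∑ y, φ (y + x) = ∑ y, φ y :=
  Equiv.sum_comp (Equiv.addRight x) φ

/-- If 27 elements of `ℤ/5`, grouped in triples of sum zero, consist of all residues, eleven times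
`b` and eleven times `-b`, then `b = 0`. -/
theorem eq_zero_of_triples (hG : Fintype.card G = 27) {g : G → ZMod 5} {x : G}
    (hline : ∀ y, g y + g (y + x) + g (y + x + x) = 0) {b c : ZMod 5}
    (hcount : ∀ Φ : ZMod 5 → ℕ, ∑ y, Φ (g y) = ∑ r, Φ r + 11 * Φ b + 11 * Φ c)
    (hbc : b + c = 0) : b = 0 := by
  by_contra hb
  obtain rfl : c = -b := (neg_eq_of_add_eq_zero_right hbc).symm
  set Φ : ZMod 5 → ℕ := fun r => if r ≠ b ∧ r ≠ -b then 1 else 0 with hΦ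
  have h1 := hcount Φ
  have h2 : ∀ b : ZMod 5, b ≠ 0 →
      ∑ r : ZMod 5, (if r ≠ b ∧ r ≠ -b then 1 else 0 : ℕ) = 3 := by decide
  have h3 : ∑ r, Φ r = 3 := h2 b hb
  have h4 : Φ b = 0 := by simp [hΦ]
  have h5 : Φ (-b) = 0 := by simp [hΦ]
  rw [h3, h4, h5] at h1
  -- Three values `±b` add up to `±b` or `±3b`, never 0 modulo 5. So every triple needs one of the
  -- only 3 points with another value, and summing over base points gives 27 ≤ 3 · 3.
  have h6 : ∀ b r s t : ZMod 5, b ≠ 0 → r + s + t = 0 →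
      1 ≤ (if r ≠ b ∧ r ≠ -b then 1 else 0 : ℕ) + (if s ≠ b ∧ s ≠ -b then 1 else 0) +
        (if t ≠ b ∧ t ≠ -b then 1 else 0) := by decide
  have h7 : ∑ _y : G, 1 ≤ ∑ y, (Φ (g y) + Φ (g (y + x)) + Φ (g (y + x + x))) :=
    Finset.sum_le_sum fun y _ => h6 b _ _ _ hb (hline y)
  rw [Finset.sum_add_distrib, Finset.sum_add_distrib, sum_comp_add (fun y => Φ (g (y + x))),
    sum_comp_add (fun y => Φ (g y)), h1] at h7
  simp [hG] at h7

/-- If each nonzero residue is taken once, then the points with values `r` and `-r` are adjacent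
points of a line. -/
theorem exists_adjacent {g : G → ZMod 5} {x : G} (hx : x ≠ 0) (h3 : ∀ y : G, y + y + y = 0)
    (hline : ∀ y, g y + g (y + x) + g (y + x + x) = 0)
    (hcount : ∀ r, r ≠ 0 → ∑ y, (if g y = r then 1 else 0 : ℕ) = 1) {r : ZMod 5} (hr : r ≠ 0) :
    ∃ e, ((g e = r ∧ g (e - x) = -r) ∨ (g e = -r ∧ g (e - x) = r)) ∧ g (e + x) = 0 := by
  have hinj : ∀ {y z}, g y = g z → g y ≠ 0 → y = z := by
    intro y z hyz hy
    have h1 := hcount (g y) hy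
    rw [← Finset.card_filter] at h1
    exact Finset.card_le_one.1 h1.le y (by simp) z (by simp [hyz])
  have hex : ∃ y, g y = r := by
    by_contra hcon
    push Not at hcon
    have h1 := hcount r hr
    rw [Finset.sum_eq_zero fun y _ => if_neg (hcon y)] at h1
    exact zero_ne_one h1
  obtain ⟨y, hy⟩ := hex
  -- Nonzero values do not repeat, so the only zero-sum completion of `r` is by 0 and `-r`.
  have key : ∀ r s t : ZMod 5, r ≠ 0 → r + s + t = 0 → s ≠ r → t ≠ r → (s = t → s = 0) →
      (s = 0 ∧ t = -r) ∨ (s = -r ∧ t = 0) := by decide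
  have hx2 : x + x ≠ 0 := fun h => hx (by simpa [h] using h3 x)
  have h1 := hline y
  rw [hy] at h1
  rcases key r _ _ hr h1
      (fun h => hx (by simpa using (hinj (h.trans hy.symm) (by rw [h]; exact hr))))
      (fun h => hx2 (by
        have := hinj (h.trans hy.symm) (by rw [h]; exact hr)
        rwa [add_assoc, add_eq_left] at this))
      (fun h => by
        by_contra h0
        exact hx (by simpa using (hinj h h0).symm)) with ⟨hs, ht⟩ | ⟨hs, ht⟩
  · refine ⟨y, Or.inl ⟨hy, ?_⟩, hs⟩
    rwa [show y - x = y + x + x by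
      rw [sub_eq_iff_eq_add, add_assoc, add_assoc, ← add_assoc x x x, h3, add_zero]]
  · exact ⟨y + x, Or.inr ⟨hs, by rwa [add_sub_cancel_right]⟩, ht⟩

/-- Eliminating `a` gives 17b + 22c = 0; combined with the triple this leaves 3b, 27b or 6b equal to
0. -/
theorem eq_zero_of_relation {b c a : A} (h2 : ∀ v : A, 2 • v = 0 → v = 0)
    (h3 : ∀ v : A, 3 • v = 0 → v = 0) {s t : A}
    (hb : b + 2 • a = 0) (hsum : 5 • a + 11 • b + 11 • c = 0) (hs : s = b ∨ s = c)
    (ht : t = b ∨ t = c) (hst : b + s + t = 0) : b = 0 := by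
  have hrel : (17 : ℤ) • b + (22 : ℤ) • c = 0 := by
    have : (17 : ℤ) • b + (22 : ℤ) • c =
        (2 : ℤ) • (5 • a + 11 • b + 11 • c) - (5 : ℤ) • (b + 2 • a) := by module
    rw [this, hsum, hb]; simp
  have h27 : 3 • (3 • (3 • b)) = 0 → b = 0 := fun h => h3 _ (h3 _ (h3 _ h))
  rcases hs with hs | hs <;> rcases ht with ht | ht <;> rw [hs, ht] at hst
  · exact h3 _ (by rw [← hst]; module)
  · refine h27 ?_
    have : 3 • (3 • (3 • b)) = (22 : ℤ) • (b + b + c) - ((17 : ℤ) • b + (22 : ℤ) • c) := by module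
    rw [this, hst, hrel]; simp
  · refine h27 ?_
    have : 3 • (3 • (3 • b)) = (22 : ℤ) • (b + c + b) - ((17 : ℤ) • b + (22 : ℤ) • c) := by module
    rw [this, hst, hrel]; simp
  · refine h3 _ (h2 _ ?_)
    have : 2 • (3 • b) = ((17 : ℤ) • b + (22 : ℤ) • c) - (11 : ℤ) • (b + c + c) := by module
    rw [this, hst, hrel]; simp

theorem sum_ite_eq_zero_and_le (P : Prop) [Decidable P] :
    ∑ r : ZMod 5, (if r = 0 ∧ P then 1 else 0 : ℕ) ≤ 1 := by
  by_cases h : P <;> simp [h]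

/-- The values outside `ℤ/5` vanish, provided one of the multiplicity-eleven values is `-2a`. -/
theorem eq_zero_of_double {g : G → ZMod 5} {h : G → A} {x : G}
    (h3G : ∀ y : G, y + y + y = 0)
    (hlineh : ∀ y, h y + h (y + x) + h (y + x + x) = 0) {a b c : A}
    (hcount : ∀ Φ : ZMod 5 → A → ℕ,
      ∑ y, Φ (g y) (h y) = ∑ r, Φ r a + 11 * Φ 0 b + 11 * Φ 0 c)
    (hsum : 5 • a + 11 • b + 11 • c = 0) (h2 : ∀ v : A, 2 • v = 0 → v = 0)
    (h3 : ∀ v : A, 3 • v = 0 → v = 0) (h11 : ∀ v : A, 11 • v = 0 → v = 0)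
    {e₁ e₂ : G} (hg : ∀ y, g y ≠ 0 → y = e₁ ∨ y = e₁ - x ∨ y = e₂ ∨ y = e₂ - x)
    (hb : b + 2 • a = 0) : ∀ y, h y = 0 := by
  have hb0 : b = 0 := by
    set Q : Finset G := Finset.univ.filter fun y => g y = 0 ∧ h y = b with hQ
    set Z : Finset G := Finset.univ.filter fun y => g y = 0 ∧ h y ≠ b ∧ h y ≠ c with hZ
    have hQcard : 11 ≤ Q.card := by
      rw [hQ, Finset.card_filter, hcount (fun r v => if r = 0 ∧ v = b then 1 else 0)]
      simp only [and_self, if_true]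
      omega
    have hZcard : Z.card ≤ 1 := by
      rw [hZ, Finset.card_filter,
        hcount (fun r v => if r = 0 ∧ v ≠ b ∧ v ≠ c then 1 else 0)]
      simp only [ne_eq, not_true_eq_false, false_and, and_false, if_false, mul_zero, add_zero]
      exact sum_ite_eq_zero_and_le _
    -- The points whose line is exceptional or meets `Z`: at most 6 + 3, fewer than the 11 points of
    -- `Q`. A point of `Q` outside `B` lies on a line with `g = 0` and all values of `h` in `{b,
    -- c}`.
    set B : Finset G := {e₁ - x, e₁, e₁ + x, e₂ - x, e₂, e₂ + x} ∪
      (Z ∪ (Z.image (fun y => y - x) ∪ Z.image (fun y => y - x - x))) with hB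
    have hBcard : B.card ≤ 9 := by
      refine (Finset.card_union_le _ _).trans ?_
      have c1 : ({e₁ - x, e₁, e₁ + x, e₂ - x, e₂, e₂ + x} : Finset G).card ≤ 6 := Finset.card_le_six
      have c2 := Finset.card_union_le Z (Z.image (fun y => y - x) ∪ Z.image (fun y => y - x - x))
      have c3 := Finset.card_union_le (Z.image (fun y => y - x)) (Z.image (fun y => y - x - x))
      have c4 : (Z.image (fun y => y - x)).card ≤ Z.card := Finset.card_image_le
      have c5 : (Z.image (fun y => y - x - x)).card ≤ Z.card := Finset.card_image_le
      omega
    obtain ⟨y, hyQ, hyB⟩ := Finset.exists_mem_notMem_of_card_lt_card (show B.card < Q.card by omega)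
    simp only [hB, Finset.mem_union, Finset.mem_insert, Finset.mem_singleton, Finset.mem_image,
      not_or, not_exists, not_and] at hyB
    obtain ⟨⟨b1, b2, b3, b4, b5, b6⟩, z0, z1, z2⟩ := hyB
    have hy := (Finset.mem_filter.1 hyQ).2
    have hxx : ∀ v : G, v + x + x = v - x := fun v => by
      rw [← sub_eq_zero, ← h3G x]; abel
    have g1 : g (y + x) = 0 := by
      by_contra hcon
      rcases hg _ hcon with q | q | q | q
      · exact b1 (eq_sub_of_add_eq q)
      · exact b3 (by rw [← sub_eq_zero, ← sub_eq_zero.2 q, ← sub_eq_zero, ← neg_eq_zero, ← h3G x]; abel)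
      · exact b4 (eq_sub_of_add_eq q)
      · exact b6 (by rw [← sub_eq_zero, ← sub_eq_zero.2 q, ← sub_eq_zero, ← neg_eq_zero, ← h3G x]; abel)
    have g2 : g (y + x + x) = 0 := by
      by_contra hcon
      rcases hg _ hcon with q | q | q | q <;> rw [hxx] at q
      · exact b3 (sub_eq_iff_eq_add.1 q)
      · exact b2 (sub_left_injective q)
      · exact b6 (sub_eq_iff_eq_add.1 q)
      · exact b5 (sub_left_injective q)
    have hs : h (y + x) = b ∨ h (y + x) = c := by
      by_contra hcon
      push Not at hcon
      exact z1 (y + x) (Finset.mem_filter.2 ⟨Finset.mem_univ _, g1, hcon⟩) (by abel)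
    have ht : h (y + x + x) = b ∨ h (y + x + x) = c := by
      by_contra hcon
      push Not at hcon
      exact z2 (y + x + x) (Finset.mem_filter.2 ⟨Finset.mem_univ _, g2, hcon⟩) (by abel)
    have hl := hlineh y
    rw [hy.2] at hl
    exact eq_zero_of_relation h2 h3 hb hsum hs ht hl
  subst hb0
  have ha : a = 0 := h2 a (by simpa using hb)
  subst ha
  have hc : c = 0 := h11 c (by simpa using hsum)
  subst hc
  intro y
  have h1 := hcount (fun _ v => if v ≠ 0 then 1 else 0)
  simp only [ne_eq, not_true_eq_false, if_false, Finset.sum_const_zero, mul_zero, add_zero] at h1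
  have h2 := Finset.sum_eq_zero_iff.1 h1 y (Finset.mem_univ y)
  by_contra hcon
  simp [hcon] at h2

/-- The shape of a derivative whose values, grouped in triples of sum zero, are distributed as in
a sum of one coset of order 5 and two constants of multiplicity eleven. -/
theorem exists_two_exceptional_points (hG : Fintype.card G = 27) (h3G : ∀ y : G, y + y + y = 0)
    {g : G → ZMod 5} {h : G → A} {x : G} (hx : x ≠ 0)
    (hlineg : ∀ y, g y + g (y + x) + g (y + x + x) = 0)
    (hlineh : ∀ y, h y + h (y + x) + h (y + x + x) = 0) {a b c : A} {b₅ c₅ : ZMod 5}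
    (hcount : ∀ Φ : ZMod 5 → A → ℕ,
      ∑ y, Φ (g y) (h y) = ∑ r, Φ r a + 11 * Φ b₅ b + 11 * Φ c₅ c)
    (hsumg : b₅ + c₅ = 0) (hsum : 5 • a + 11 • b + 11 • c = 0)
    (h2 : ∀ v : A, 2 • v = 0 → v = 0) (h3 : ∀ v : A, 3 • v = 0 → v = 0)
    (h11 : ∀ v : A, 11 • v = 0 → v = 0) :
    (∀ y, h y = 0) ∧ ∃ e₁ e₂, (∀ y, g y ≠ 0 → y = e₁ ∨ y = e₁ - x ∨ y = e₂ ∨ y = e₂ - x) ∧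
      g (e₁ - x) ≠ 0 ∧ g (e₂ - x) ≠ 0 ∧ g (e₁ + x) = 0 ∧ g (e₂ + x) = 0 ∧
      e₁ - e₂ ≠ 0 ∧ e₁ - e₂ ≠ x ∧ e₁ - e₂ ≠ -x := by
  have hb₅ : b₅ = 0 := eq_zero_of_triples hG hlineg (fun Φ => hcount fun r _ => Φ r) hsumg
  subst hb₅
  obtain rfl : c₅ = 0 := by simpa using hsumg
  have hone : ∀ r, r ≠ 0 → ∑ y, (if g y = r then 1 else 0 : ℕ) = 1 := by
    intro r hr
    rw [hcount (fun s _ => if s = r then 1 else 0)]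
    simp [hr.symm]
  have hinj : ∀ {y z}, g y = g z → g y ≠ 0 → y = z := by
    intro y z hyz hy
    have h1 := hone (g y) hy
    rw [← Finset.card_filter] at h1
    exact Finset.card_le_one.1 h1.le y (by simp) z (by simp [hyz])
  -- 1 and 2 represent the nonzero residues modulo 5 up to sign.
  obtain ⟨e₁, he₁, hz₁⟩ := exists_adjacent hx h3G hlineg hone (r := 1) (by decide)
  obtain ⟨e₂, he₂, hz₂⟩ := exists_adjacent hx h3G hlineg hone (r := 2) (by decide)
  have hres : ∀ s : ZMod 5, s ≠ 0 → s = 1 ∨ s = -1 ∨ s = 2 ∨ s = -2 := by decide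
  have hg : ∀ y, g y ≠ 0 → y = e₁ ∨ y = e₁ - x ∨ y = e₂ ∨ y = e₂ - x := by
    intro y hy
    rcases he₁ with ⟨p1, p2⟩ | ⟨p1, p2⟩ <;> rcases he₂ with ⟨q1, q2⟩ | ⟨q1, q2⟩ <;>
    rcases hres _ hy with hs | hs | hs | hs <;>
    first
      | exact Or.inl (hinj (hs.trans p1.symm) hy)
      | exact Or.inr (Or.inl (hinj (hs.trans p2.symm) hy))
      | exact Or.inr (Or.inr (Or.inl (hinj (hs.trans q1.symm) hy)))
      | exact Or.inr (Or.inr (Or.inr (hinj (hs.trans q2.symm) hy)))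
  have d1 : g e₁ = 1 ∨ g e₁ = -1 := he₁.imp And.left And.left
  have d2 : g (e₁ - x) = 1 ∨ g (e₁ - x) = -1 := (he₁.imp And.right And.right).symm
  have d3 : g e₂ = 2 ∨ g e₂ = -2 := he₂.imp And.left And.left
  have d4 : g (e₂ - x) = 2 ∨ g (e₂ - x) = -2 := (he₂.imp And.right And.right).symm
  have hne : ∀ s t : ZMod 5, (s = 1 ∨ s = -1) → (t = 2 ∨ t = -2) → s ≠ t := by decide
  have hn1 : ∀ s : ZMod 5, (s = 1 ∨ s = -1) → s ≠ 0 := by decide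
  have hn2 : ∀ s : ZMod 5, (s = 2 ∨ s = -2) → s ≠ 0 := by decide
  have hdiff : e₁ - e₂ ≠ 0 := fun hh => hne _ _ d1 d3 (by rw [sub_eq_zero.1 hh])
  refine ⟨?_, e₁, e₂, hg, hn1 _ d2, hn2 _ d4, hz₁, hz₂, hdiff, ?_, ?_⟩
  · have hval : ∀ y, g y ≠ 0 → h y = a := by
      intro y hy
      have h1 := hcount (fun r v => if r ≠ 0 ∧ v ≠ a then 1 else 0)
      simp only [ne_eq, not_true_eq_false, false_and, and_false, if_false, Finset.sum_const_zero,
        mul_zero, add_zero] at h1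
      have h2 := Finset.sum_eq_zero_iff.1 h1 y (Finset.mem_univ y)
      by_contra hcon
      simp [hcon, hy] at h2
    have hthird : ∀ e, g e ≠ 0 → g (e - x) ≠ 0 → h (e + x) + 2 • a = 0 := by
      intro e h1 h2
      have := hlineh (e - x)
      rw [sub_add_cancel, hval _ h1, hval _ h2] at this
      rw [← this]; abel
    have t1 := hthird e₁ (hn1 _ d1) (hn1 _ d2)
    have t2 := hthird e₂ (hn2 _ d3) (hn2 _ d4)
    -- Both points `e₁ + x` and `e₂ + x` have `g = 0` and `h = -2a`, but the coset of order 5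
    -- accounts for only one point with `g = 0`.
    have hbc : b + 2 • a = 0 ∨ c + 2 • a = 0 := by
      by_contra hcon
      push Not at hcon
      have h1 := hcount (fun r v => if r = 0 ∧ v + 2 • a = 0 then 1 else 0)
      simp only [true_and, if_neg hcon.1, if_neg hcon.2, mul_zero, add_zero] at h1
      have h4 : ∑ r : ZMod 5, (if r = 0 ∧ a + 2 • a = 0 then 1 else 0 : ℕ) ≤ 1 :=
        sum_ite_eq_zero_and_le _
      rw [← h1, ← Finset.card_filter] at h4
      have := Finset.card_le_one.1 h4 (e₁ + x) (by simp [hz₁, t1]) (e₂ + x) (by simp [hz₂, t2])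
      exact hdiff (by rw [add_right_cancel this, sub_self])
    rcases hbc with hb | hc
    · exact eq_zero_of_double h3G hlineh hcount hsum h2 h3 h11 hg hb
    · exact eq_zero_of_double h3G hlineh (b := c) (c := b)
        (fun Φ => by rw [hcount Φ]; ring) (by rw [← hsum]; abel) h2 h3 h11 hg hc
  · intro hh
    exact hne _ _ d2 d3 (by rw [sub_eq_iff_eq_add.1 hh, add_sub_cancel_left])
  · intro hh
    exact hne _ _ d1 d4 (by rw [sub_eq_iff_eq_add.1 hh, neg_add_eq_sub])

end Triples

/-! ### Projection to Z/5 × Z/q and reduction modulo 11 -/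

section Final

theorem exists_isPrimitiveRoot {K : Type*} [Field K] [IsAlgClosed K] {n : ℕ} [NeZero (n : K)] :
    ∃ z : K, IsPrimitiveRoot z n := by
  have hn : 0 < n := Nat.pos_of_ne_zero fun h => NeZero.ne (n : K) (by simp [h])
  obtain ⟨z, hz⟩ := IsAlgClosed.exists_root (Polynomial.cyclotomic n K)
    (Polynomial.degree_cyclotomic_pos n K hn).ne'
  exact ⟨z, Polynomial.isRoot_cyclotomic_iff.1 hz⟩

theorem zmod_eq_zero_of_nsmul {q k : ℕ} (h : k.Coprime q) (v : ZMod q) (hv : k • v = 0) :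
    v = 0 := by
  rw [nsmul_eq_mul] at hv
  exact eq_zero_of_coprime_mul h hv (by rw [ZMod.natCast_self, zero_mul])

theorem map_torsion_eq_zero {m q p : ℕ} [NeZero m] (φ : ZMod m →+* ZMod q) (h : p.Coprime q)
    {k : ZMod m} (hk : k ∈ torsion m p) : φ k = 0 := by
  refine zmod_eq_zero_of_nsmul h _ ?_
  rw [nsmul_eq_mul, ← map_natCast φ, ← map_mul, mem_torsion.1 hk, map_zero]

theorem castHom_eq_zero_iff {m d : ℕ} [NeZero m] (h : d ∣ m) (i : ZMod m) :
    ZMod.castHom h (ZMod d) i = 0 ↔ d ∣ i.val := by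
  conv_lhs => rw [← ZMod.natCast_zmod_val i, map_natCast]
  exact ZMod.natCast_eq_zero_iff _ _

/-- As 5 does not divide `m'`, each coset of the 5-torsion maps bijectively onto Z/5. -/
theorem sum_torsion_five {m' : ℕ} [NeZero m'] (h5 : ¬ 5 ∣ m') {M : Type*} [AddCommMonoid M]
    (Φ : ZMod 5 → M) (a : ZMod (5 * m')) :
    ∑ k ∈ torsion (5 * m') 5, Φ (ZMod.castHom (Nat.dvd_mul_right 5 m') (ZMod 5) (a + k)) =
      ∑ r, Φ r := by
  classical
  set π := ZMod.castHom (Nat.dvd_mul_right 5 m') (ZMod 5) with hπ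
  have hcop : Nat.Coprime 5 m' := (Nat.Prime.coprime_iff_not_dvd (by norm_num)).2 h5
  have hinj : Set.InjOn (fun k => π (a + k)) (torsion (5 * m') 5) := by
    intro k hk l hl hkl
    rw [Finset.mem_coe, mem_torsion] at hk hl
    simp only [map_add, add_right_inj] at hkl
    have h1 : π (k - l) = 0 := by rw [map_sub, hkl, sub_self]
    rw [hπ, castHom_eq_zero_iff] at h1
    obtain ⟨v, hv⟩ := h1
    refine sub_eq_zero.1 (eq_zero_of_coprime_mul hcop ?_ ?_)
    · rw [mul_sub, hk, hl, sub_zero]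
    · rw [← ZMod.natCast_zmod_val (k - l), hv, ← Nat.cast_mul, ZMod.natCast_eq_zero_iff]
      exact ⟨v, by ring⟩
  have himg : (torsion (5 * m') 5).image (fun k => π (a + k)) = Finset.univ := by
    refine Finset.eq_univ_of_card _ ?_
    rw [Finset.card_image_of_injOn hinj, card_torsion (Nat.dvd_mul_right 5 m'), ZMod.card]
  rw [← himg, Finset.sum_image hinj]

theorem autocorr_ne {m' : ℕ} [NeZero m'] (h2 : ¬ 2 ∣ m') (h3 : ¬ 3 ∣ m') (h5 : ¬ 5 ∣ m') {ζ : ℂ}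
    (hζ : IsPrimitiveRoot ζ (5 * m')) {G : Type*} [AddCommGroup G] [Fintype G]
    (hG : Fintype.card G = 27) (h3G : ∀ y : G, y + y + y = 0) {f : G → ZMod (5 * m')}
    (hf : IsGBF ζ f) {x : G} (hx : x ≠ 0) (α β γ : ZMod (5 * m')) :
    autocorr f x ≠ D (5 * m') 5 * gpow α + D (5 * m') 11 * (gpow β + gpow γ) := by
  classical
  intro hE
  have hsum : ∀ {M : Type} [AddCommMonoid M] (φ : ZMod (5 * m') → M),
      ∑ y, φ (f (x + y) - f y) = ∑ k ∈ torsion (5 * m') 5, φ (α + k) +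
        (∑ k ∈ torsion (5 * m') 11, φ (β + k) + ∑ k ∈ torsion (5 * m') 11, φ (γ + k)) := by
    intro M _ φ
    rw [← extend_autocorr φ f x, hE, mul_add, extend_add, extend_add, extend_D_mul_gpow,
      extend_D_mul_gpow, extend_D_mul_gpow]
  -- Otherwise `D _ 11` is a single element, and the sizes give 5 + 1 + 1 instead of 27.
  have h11 : 11 ∣ 5 * m' := by
    by_contra h11
    have hcop : Nat.Coprime 11 (5 * m') := (Nat.Prime.coprime_iff_not_dvd (by norm_num)).2 h11
    have ht : torsion (5 * m') 11 = {0} := by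
      ext k
      rw [mem_torsion, Finset.mem_singleton]
      constructor
      · intro hk
        exact eq_zero_of_coprime_mul hcop hk (by rw [ZMod.natCast_self, zero_mul])
      · rintro rfl; simp
    have h1 := hsum (fun _ => (1 : ℕ))
    rw [ht] at h1
    simp [hG, card_torsion (Nat.dvd_mul_right 5 m')] at h1
  have hp11 : Nat.Prime 11 := by norm_num
  have h11' : 11 ∣ m' := (Nat.Coprime.dvd_mul_left (by norm_num : Nat.Coprime 11 5)).1 h11
  obtain ⟨k, q, hm', hq, hq11⟩ := exists_eq_pow_mul (m := m') hp11
  have hqm' : q ∣ m' := ⟨11 ^ k, by rw [hm']; ring⟩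
  have hqm : q ∣ 5 * m' := hqm'.mul_left 5
  have hcop : ∀ p : ℕ, p.Prime → ¬ p ∣ m' → p.Coprime q := fun p hp hpm =>
    (Nat.Prime.coprime_iff_not_dvd hp).2 fun h => hpm (h.trans hqm')
  have hc2 := hcop 2 (by norm_num) h2
  have hc3 := hcop 3 (by norm_num) h3
  have hc5 := hcop 5 (by norm_num) h5
  set π₅ := ZMod.castHom (Nat.dvd_mul_right 5 m') (ZMod 5) with hπ₅
  set π := ZMod.castHom hqm (ZMod q) with hπ
  have hcount : ∀ {M : Type} [AddCommMonoid M] (Φ : ZMod 5 → ZMod q → M),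
      ∑ y, Φ (π₅ (f (x + y) - f y)) (π (f (x + y) - f y)) =
        ∑ r, Φ r (π α) + 11 • Φ (π₅ β) (π β) + 11 • Φ (π₅ γ) (π γ) := by
    intro M _ Φ
    rw [hsum (fun i => Φ (π₅ i) (π i)), ← sum_torsion_five h5 (fun r => Φ r (π α)) α, add_assoc]
    have hT : ∀ δ, ∑ k ∈ torsion (5 * m') 11, Φ (π₅ (δ + k)) (π (δ + k)) =
        11 • Φ (π₅ δ) (π δ) := by
      intro δ
      rw [Finset.sum_congr rfl (g := fun _ => Φ (π₅ δ) (π δ)), Finset.sum_const, card_torsion h11]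
      intro k hk
      rw [map_add, map_add, map_torsion_eq_zero π₅ (by norm_num) hk,
        map_torsion_eq_zero π hq11 hk, add_zero, add_zero]
    rw [hT, hT]
    congr 1
    refine Finset.sum_congr rfl fun k hk => ?_
    rw [map_add π, map_torsion_eq_zero π hc5 hk, add_zero]
  have htel : ∀ {M : Type} [AddCommGroup M] (φ : ZMod (5 * m') →+ M),
      ∑ y, φ (f (x + y) - f y) = 0 := by
    intro M _ φ
    simp_rw [map_sub, Finset.sum_sub_distrib]
    rw [sub_eq_zero]
    exact Equiv.sum_comp (Equiv.addLeft x) (fun y => φ (f y))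
  have hline : ∀ {M : Type} [AddCommGroup M] (φ : ZMod (5 * m') →+ M) (y : G),
      φ (f (x + y) - f y) + φ (f (x + (y + x)) - f (y + x)) +
        φ (f (x + (y + x + x)) - f (y + x + x)) = 0 := by
    intro M _ φ y
    rw [← map_add, ← map_add, show x + (y + x) = y + x + x by abel,
      show x + (y + x + x) = y + (x + x + x) by abel, h3G, add_zero, add_comm x y]
    convert map_zero φ
    abel
  obtain ⟨hzero, e₁, e₂, hg, hd₁, hd₂, hz₁, hz₂, hne, hp, hn⟩ :=
    exists_two_exceptional_points hG h3G (g := fun y => π₅ (f (x + y) - f y))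
      (h := fun y => π (f (x + y) - f y)) hx (hline π₅.toAddMonoidHom) (hline π.toAddMonoidHom)
      (a := π α) (b := π β) (c := π γ) (b₅ := π₅ β) (c₅ := π₅ γ)
      (fun Φ => by simpa using hcount Φ)
      (by
        have h1 := hcount (fun r _ => r)
        rw [show ∑ y, π₅ (f (x + y) - f y) = 0 from htel π₅.toAddMonoidHom,
          show ∑ r : ZMod 5, r = 0 by decide, zero_add] at h1
        rw [h1, nsmul_eq_mul, nsmul_eq_mul, show ((11 : ℕ) : ZMod 5) = 1 by decide, one_mul,
          one_mul])
      (by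
        have h1 := hcount (fun _ v => v)
        rw [show ∑ y, π (f (x + y) - f y) = 0 from htel π.toAddMonoidHom, Finset.sum_const,
          Finset.card_univ, ZMod.card] at h1
        exact h1.symm)
      (zmod_eq_zero_of_nsmul hc2) (zmod_eq_zero_of_nsmul hc3) (zmod_eq_zero_of_nsmul hq11)
  have : Fact (Nat.Prime 11) := ⟨hp11⟩
  -- In characteristic 11, roots of unity do not see the 11-part of an exponent: `z` of order `5 *
  -- q` is still a root of the cyclotomic polynomial of index `5 * m'`, and `ψ` depends only on `π₅`
  -- and `π`.
  let K := AlgebraicClosure (ZMod 11)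
  have : CharP K 11 := inferInstance
  have hnK : NeZero ((5 * q : ℕ) : K) := ⟨by
    rw [Ne, CharP.cast_eq_zero_iff K 11]
    intro h
    exact hq ((Nat.Coprime.dvd_mul_left (by norm_num : Nat.Coprime 11 5)).1 h)⟩
  obtain ⟨z, hz⟩ := exists_isPrimitiveRoot (K := K) (n := 5 * q)
  have hroot : (Polynomial.cyclotomic (5 * m') K).IsRoot z := by
    have h1 := (Polynomial.isRoot_cyclotomic_prime_pow_mul_iff_of_charP (m := 5 * q) (k := k)
      (p := 11) (μ := z)).2 hz
    have h2 : 11 ^ k * (5 * q) = 5 * m' := by rw [hm']; ring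
    rwa [h2] at h1
  have hzm : z ^ (5 * m') = 1 := by
    rw [hm', show 5 * (11 ^ k * q) = 5 * q * 11 ^ k by ring, pow_mul, hz.pow_eq_one, one_pow]
  set ψ := AddChar.zmodChar (5 * m') hzm with hψ
  have hψ1 : ∀ i, ψ i = 1 ↔ π₅ i = 0 ∧ π i = 0 := by
    intro i
    rw [hψ, AddChar.zmodChar_apply, hz.pow_eq_one_iff_dvd, hπ₅, hπ, castHom_eq_zero_iff,
      castHom_eq_zero_iff]
    exact ⟨fun h => ⟨(dvd_mul_right _ _).trans h, (dvd_mul_left _ _).trans h⟩,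
      fun h => hc5.mul_dvd_of_dvd_of_dvd h.1 h.2⟩
  have hψne : ∀ i, ψ i ≠ 0 := char_ne_zero ψ
  have hψsub : ∀ i j, ψ i = ψ j ↔ ψ (i - j) = 1 := by
    intro i j
    rw [AddChar.map_sub_eq_div, div_eq_one_iff_eq (hψne j)]
  -- As `π` of every difference vanishes, only `π₅` decides whether `ψ ∘ f` changes along `x`.
  have hu : ∀ y, ψ (f (x + y)) = ψ (f y) ↔ π₅ (f (x + y) - f y) = 0 := by
    intro y
    rw [hψsub, hψ1]
    exact and_iff_left (hzero y)
  have hu' : ∀ y, ψ (f y) = ψ (f (y - x)) ↔ π₅ (f (x + (y - x)) - f (y - x)) = 0 := by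
    intro y
    rw [← hu, add_sub_cancel]
  have hs : ∀ e, π₅ (f (x + (e + x)) - f (e + x)) = 0 → ψ (f (e + x)) = ψ (f (e - x)) := by
    intro e he
    rw [← (hu (e + x)).2 he, show x + (e + x) = e - x by
      rw [← sub_eq_zero, ← h3G x]; abel]
  refine not_two_exceptional_points h3G (K := K) ?_ (u := fun y => ψ (f y))
    (u' := fun y => ψ (-f y)) ?_ ?_ hx hne hp hn ?_ ?_ ?_ (hs e₁ hz₁) (hs e₂ hz₂)
  · have h2K : ((2 : ℕ) : K) ≠ 0 := by
      rw [Ne, CharP.cast_eq_zero_iff K 11]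
      norm_num
    exact_mod_cast h2K
  · intro y y'
    simp only [AddChar.map_neg_eq_inv]
    exact inv_inj.symm
  · intro w hw
    rw [← sum_pow_val_autocorr_eq_zero hζ hf hw hroot]
    refine Finset.sum_congr rfl fun y _ => ?_
    rw [← AddChar.map_add_eq_mul, ← sub_eq_add_neg]
    rfl
  · intro y h1 h2 h3 h4
    rw [hu']
    by_contra hcon
    rcases hg _ hcon with h | h | h | h
    · exact h2 (sub_eq_iff_eq_add.1 h)
    · exact h1 (sub_left_injective h)
    · exact h4 (sub_eq_iff_eq_add.1 h)
    · exact h3 (sub_left_injective h)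
  · exact fun h => hd₁ ((hu' e₁).1 h)
  · exact fun h => hd₂ ((hu' e₂).1 h)

end Final

end GBF

theorem mainTheorem5 (m' : ℕ) [NeZero m'] (h2 : ¬ 2 ∣ m') (h3 : ¬ 3 ∣ m') (h5 : ¬ 5 ∣ m')
    (ζ : ℂ) (hζ : IsPrimitiveRoot ζ (5 * m'))
    (f : (Fin 3 → ZMod 3) → ZMod (5 * m')) (hf : GBF.IsGBF ζ f) :
    (∀ x : Fin 3 → ZMod 3, x ≠ 0 → ∀ α β γ : ℤ,
      GBF.autocorr f x ≠
        GBF.D (5 * m') 5 * GBF.gpow (α : ZMod (5 * m')) +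
          GBF.D (5 * m') 11 *
            (GBF.gpow (β : ZMod (5 * m')) + GBF.gpow (γ : ZMod (5 * m')))) ∧
    (∀ x : Fin 3 → ZMod 3, x ≠ 0 →
      GBF.IsVSum ζ (GBF.autocorr f x) ∧ ¬ 11 ∣ GBF.cExponent ζ (GBF.autocorr f x)) := by
  have hG : Fintype.card (Fin 3 → ZMod 3) = 27 := by simp [ZMod.card]
  have h3G : ∀ y : Fin 3 → ZMod 3, y + y + y = 0 := by
    have h : ∀ a : ZMod 3, a + a + a = 0 := by decide
    exact fun y => funext fun i => h (y i)
  have hprimes : ∀ q : ℕ, q.Prime → q ∣ 5 * m' → 5 ≤ q := by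
    intro q hq hqm
    rcases (Nat.Prime.dvd_mul hq).1 hqm with h | h
    · exact ((Nat.prime_dvd_prime_iff_eq hq (by norm_num)).1 h).ge
    · by_contra hlt
      have hq2 := hq.two_le
      have : q = 2 ∨ q = 3 ∨ q = 4 := by omega
      rcases this with rfl | rfl | rfl
      · exact h2 h
      · exact h3 h
      · exact absurd hq (by norm_num)
  refine ⟨fun x hx α β γ => GBF.autocorr_ne h2 h3 h5 hζ hG h3G hf hx α β γ, fun x hx => ?_⟩
  have hv := GBF.isVSum_autocorr hζ hf hx
  refine ⟨hv, fun h11 => ?_⟩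
  obtain ⟨a, b, c, h⟩ := GBF.exists_eq_of_eleven_dvd_cExponent hζ hprimes hv
    (by rw [GBF.sum_coeffFun_autocorr, hG]) h11
  exact GBF.autocorr_ne h2 h3 h5 hζ hG h3G hf hx a b c h
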